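/- Let $\mathbb{F}$ be a field. A symplectic alternating algebra (SAA) over $\mathbb{F}$ is an $\mathbb{F}$-vector space $L$ with a non-degenerate alternating bilinear form $(\cdot,\cdot)$ and a bilinear product satisfying $x\cdot x=0$ and $(x\cdot y,z)=(y\cdot z,x)$ for all $x,y,z\in L$. Two SAAs are the same if there is a linear bijection between them that preserves the form and the product. For subspaces $A,B\le L$ let $AB$ be the span of all $a\cdot b$ with $a\in A$, $b\in B$; put $L^1=L$, $L^{n+1}=L^nL$. $L$ is nilpotent of class $c$ if $L^{c+1}=0\neq L^c$. The centre is $Z(L)=\{x\in L: xL=0\}$, and it is isotropic if $(x,y)=0$ for all $x,y\in Z(L)$. Let $I_1=L^5L^2$, $I_2=L^7$, $I_3=L^6$, let $k$ be the smallest index with $I_k\cap L^4L^3\neq 0$, and put $U=\{x\in L^4: xL^3\le I_k\}$. For $r\in\mathbb{F}$, a $10$-dimensional SAA $L$ has the presentation $$\mathcal{P}_{10}^{(2,4)}(r):\ (x_3y_4,y_5)=r,\ (x_2y_3,y_5)=1,\ (x_1y_2,y_5)=1,\ (x_1y_3,y_4)=1,\ (y_1y_2,y_4)=1$$ if it has a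 basis $x_1,y_1,\dots,x_5,y_5$ with $(x_i,x_j)=(y_i,y_j)=0$ and $(x_i,y_j)=\delta_{ij}$ for all $i,j$, such that $x_ix_j=0$ for all $i,j$, $x_iy_j=0$ for $j\le i$, and among the values $(x_iy_j,y_k)$ and $(y_iy_j,y_k)$ with $1\le i<j<k\le 5$ the listed ones are as displayed and all the others are $0$. Proposition 3.4. (1) Let $L$ be a nilpotent SAA of dimension $10$ and class $7$ with an isotropic centre of dimension $2$, such that $L^4L^3=L^7$ and $\dim UL^2=2$. Then $L$ has a presentation $\mathcal{P}_{10}^{(2,4)}(r)$ for some $r\neq 0$. (2) Conversely, for every $r\ne 0$ there is an SAA with the presentation $\mathcal{P}_{10}^{(2,4)}(r)$, and every such SAA has all the properties listed in (1). (3) For $r,s\neq 0$, the presentations $\mathcal{P}_{10}^{(2,4)}(r)$ and $\mathcal{P}_{10}^{(2,4)}(s)$ describe the same algebra (any SAA with the first is isomorphic to any SAA with the second) if and only if $s/r\in(\mathbb{F}^*)^{11}$. -/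

import Mathlib

/-- A symplectic alternating algebra over `F` on the vector space `V`: a non-degenerate alternating
form together with an alternating bilinear product satisfying `(x · y, z) = (y · z, x)`. -/
structure SAA (F V : Type*) [Field F] [AddCommGroup V] [Module F V] where
  form : V →ₗ[F] V →ₗ[F] F
  form_isAlt : form.IsAlt
  form_nondegenerate : form.Nondegenerate
  mul : V →ₗ[F] V →ₗ[F] V
  mul_self : ∀ x, mul x x = 0
  form_mul : ∀ x y z, form (mul x y) z = form (mul y z) x

/-- A nilpotent presentation: the triple values `(xᵢ yⱼ, yₖ) = xyy i j k` and
`(yᵢ yⱼ, yₖ) = yyy i j k`. The indices are `1, …, n`, and only the values at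
`1 ≤ i < j < k ≤ n` matter. -/
structure NilpotentPresentation (F : Type*) where
  xyy : ℕ → ℕ → ℕ → F
  yyy : ℕ → ℕ → ℕ → F

namespace SAA

variable {F V W : Type*} [Field F] [AddCommGroup V] [Module F V] [AddCommGroup W] [Module F W]

/-- The subspace `A B` spanned by all the products `a · b` with `a ∈ A` and `b ∈ B`. -/
def prod (L : SAA F V) (A B : Submodule F V) : Submodule F V :=
  Submodule.map₂ L.mul A B

/-- The powers `L¹ = L`, `Lⁿ⁺¹ = Lⁿ L` (with the harmless convention `L⁰ = L`). -/
def power (L : SAA F V) : ℕ → Submodule F V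
  | 0 => ⊤
  | 1 => ⊤
  | n + 2 => L.prod (L.power (n + 1)) ⊤

/-- `L` is nilpotent: some power of `L` vanishes. -/
def IsNilpotent (L : SAA F V) : Prop := ∃ c, L.power (c + 1) = ⊥

/-- The nilpotence class of `L`: the least `c` with `Lᶜ⁺¹ = 0` (meaningful for nilpotent `L`). -/
noncomputable def nilpotenceClass (L : SAA F V) : ℕ := sInf {c | L.power (c + 1) = ⊥}

/-- The subspace `{x ∈ A : x B ≤ C}`. -/
def transporter (L : SAA F V) (A B C : Submodule F V) : Submodule F V where
  carrier := {x | x ∈ A ∧ ∀ y ∈ B, L.mul x y ∈ C}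
  zero_mem' := ⟨A.zero_mem, fun y _ => by simp⟩
  add_mem' := fun {u v} hu hv => ⟨A.add_mem hu.1 hv.1, fun y hy => by
    rw [map_add, LinearMap.add_apply]
    exact C.add_mem (hu.2 y hy) (hv.2 y hy)⟩
  smul_mem' := fun c u hu => ⟨A.smul_mem c hu.1, fun y hy => by
    rw [map_smul, LinearMap.smul_apply]
    exact C.smul_mem c (hu.2 y hy)⟩

/-- The centre `Z(L) = {x : x L = 0}`. -/
def centre (L : SAA F V) : Submodule F V := L.transporter ⊤ ⊤ ⊥

/-- A subspace is isotropic if the form vanishes on it. -/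
def IsIsotropic (L : SAA F V) (S : Submodule F V) : Prop :=
  ∀ x ∈ S, ∀ y ∈ S, L.form x y = 0

open Classical in
/-- `I_k` for the smallest `k ∈ {1, 2, 3}` with `I_k ∩ L⁴L³ ≠ 0`, where
`I₁ = L⁵L²`, `I₂ = L⁷`, `I₃ = L⁶`. (For algebras of class `7`, one has `0 ≠ L⁴L³ ≤ L⁶`,
so that such a `k` exists.) -/
noncomputable def firstMeet (L : SAA F V) : Submodule F V :=
  if L.prod (L.power 5) (L.power 2) ⊓ L.prod (L.power 4) (L.power 3) ≠ ⊥ then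
    L.prod (L.power 5) (L.power 2)
  else if L.power 7 ⊓ L.prod (L.power 4) (L.power 3) ≠ ⊥ then
    L.power 7
  else
    L.power 6

/-- The characteristic subspace `U = {x ∈ L⁴ : x L³ ≤ I_k}`. -/
noncomputable def U (L : SAA F V) : Submodule F V :=
  L.transporter (L.power 4) (L.power 3) L.firstMeet

/-- A standard basis `x₁, y₁, …, xₙ, yₙ`; here `b (Sum.inl i)` is `xᵢ₊₁` and `b (Sum.inr i)` is
`yᵢ₊₁` for `i = 0, …, n - 1`. -/
structure IsStandardBasis (L : SAA F V) {n : ℕ} (b : Module.Basis (Fin n ⊕ Fin n) F V) :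
    Prop where
  form_x_x : ∀ i j, L.form (b (Sum.inl i)) (b (Sum.inl j)) = 0
  form_y_y : ∀ i j, L.form (b (Sum.inr i)) (b (Sum.inr j)) = 0
  form_x_y : ∀ i j, L.form (b (Sum.inl i)) (b (Sum.inr j)) = if i = j then 1 else 0

/-- `L` is described by the nilpotent presentation `P` with respect to the standard basis `b`.
All triple values that `P` does not list are zero, that is `xᵢ xⱼ = 0` for all `i, j` and
`xᵢ yⱼ = 0` for `j ≤ i`. -/
structure IsPresentedBy (L : SAA F V) {n : ℕ} (b : Module.Basis (Fin n ⊕ Fin n) F V)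
    (P : NilpotentPresentation F) : Prop where
  standard : L.IsStandardBasis b
  x_mul_x : ∀ i j, L.mul (b (Sum.inl i)) (b (Sum.inl j)) = 0
  x_mul_y : ∀ i j, j ≤ i → L.mul (b (Sum.inl i)) (b (Sum.inr j)) = 0
  triple_xyy : ∀ i j k : Fin n, i < j → j < k →
    L.form (L.mul (b (Sum.inl i)) (b (Sum.inr j))) (b (Sum.inr k)) =
      P.xyy (i + 1) (j + 1) (k + 1)
  triple_yyy : ∀ i j k : Fin n, i < j → j < k →
    L.form (L.mul (b (Sum.inr i)) (b (Sum.inr j))) (b (Sum.inr k)) =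
      P.yyy (i + 1) (j + 1) (k + 1)

/-- `L` has the `2n`-dimensional nilpotent presentation `P` with respect to some standard basis. -/
def HasPresentation (L : SAA F V) (n : ℕ) (P : NilpotentPresentation F) : Prop :=
  ∃ b : Module.Basis (Fin n ⊕ Fin n) F V, L.IsPresentedBy b P

/-- Two symplectic alternating algebras are the same (isomorphic): there is a linear bijection that
preserves the form and the product. -/
def Isomorphic (L : SAA F V) (M : SAA F W) : Prop :=
  ∃ e : V ≃ₗ[F] W, (∀ x y, M.form (e x) (e y) = L.form x y) ∧
    ∀ x y, e (L.mul x y) = M.mul (e x) (e y)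

/-- `L` is nilpotent of dimension `10` and class `7` with an isotropic centre of dimension `2`,
`L⁴L³ = L⁷` and `dim UL² = 2`. -/
structure IsOfType24 (L : SAA F V) : Prop where
  dim : Module.finrank F V = 10
  nilpotent : L.IsNilpotent
  centre_isotropic : L.IsIsotropic L.centre
  dim_centre : Module.finrank F L.centre = 2
  class_eq : L.nilpotenceClass = 7
  prod_eq : L.prod (L.power 4) (L.power 3) = L.power 7
  dim_UL2 : Module.finrank F (L.prod L.U (L.power 2)) = 2

end SAA

/-- The presentation `P₁₀^(2,4)(r)`: `(x₃y₄, y₅) = r`, `(x₂y₃, y₅) = 1`, `(x₁y₂, y₅) = 1`,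
`(x₁y₃, y₄) = 1`, `(y₁y₂, y₄) = 1`, all the other values being zero. -/
def presentation24 {F : Type*} [Field F] (r : F) : NilpotentPresentation F where
  xyy
    | 3, 4, 5 => r
    | 2, 3, 5 => 1
    | 1, 2, 5 => 1
    | 1, 3, 4 => 1
    | _, _, _ => 0
  yyy
    | 1, 2, 4 => 1
    | _, _, _ => 0

namespace SAA

variable {F V W : Type*} [Field F] [AddCommGroup V] [Module F V] [AddCommGroup W] [Module F W]

/-! ### Identities for the form and the product; duality between powers and centres -/

section Basic

variable (L : SAA F V)

/-! Indices of basis vectors in these comments run from 1 to 5, as in the presentation; in the code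
they run from 0 to 4.

Everything rests on the alternating trilinear form (xy, z) and on one duality: x is orthogonal to AB
exactly when xB is orthogonal to A (`mem_perp_prod`). So the complement of L^(k+1) is the k-th
centre, and L^8 = 0 places the lower central series inside the upper one. A centre of dimension 2
makes L/L^2 two-dimensional; with class 7 this forces the dimensions 10, 8, 7, 6, 4, 3, 2 of L^1,
..., L^7 and makes L^7, L^6, L^5 the first three centres (`hasMaximalDims`,
`HasMaximalDims.perp_power`).

Then I = L^5 L^2 is a line in L^7 = L^4 L^3, and together with U it refines the powers to a full
characteristic flag I < L^7 < L^6 < L^5 < U < L^4 < L^3 < L^2 < I^⊥. In a standard basis adapted to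
it (`exists_adapted_frame`), four of the twenty triple values vanish and five leading ones do not:
if one of these vanished, then L^4 L^3 ≤ I, or UL^2 ≤ I, or some x_i would lie one step too deep in
the flag (`exists_isNormalFrame`). Transvections clear the other eleven values
(`IsNormalFrame.exists_reduced`).

What is left is the torus y_i ↦ s_i y_i, x_i ↦ s_i⁻¹ x_i. Normalising four leading values to 1 gives
four equations in five unknowns. The remaining freedom is s = (t⁻¹, t⁻³, t⁻⁵, t⁴, t²), and it
multiplies r = (x_3 y_4, y_5) by t^(5+4+2) = t^11. Conversely, an isomorphism preserves the flag,
hence is triangular, and its diagonal satisfies the same equations (`IsChart.exists_pow_eleven`).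
The properties in part (2) are checked in an explicit coordinate model, where the flag consists of
coordinate subspaces. -/

theorem mul_swap (x y : V) : L.mul y x = -L.mul x y := by
  have h := L.mul_self (x + y)
  simp only [map_add, LinearMap.add_apply, L.mul_self, zero_add, add_zero] at h
  exact eq_neg_of_add_eq_zero_left h

theorem form_swap (x y : V) : L.form y x = -L.form x y :=
  (L.form_isAlt.neg x y).symm

theorem form_mul_swap_left (x y z : V) : L.form (L.mul y x) z = -L.form (L.mul x y) z := by
  rw [L.mul_swap x y]; simp

theorem form_mul_swap_right (x y z : V) : L.form (L.mul x z) y = -L.form (L.mul x y) z := by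
  rw [L.form_mul x z y, L.form_mul_swap_left y z x, ← L.form_mul x y z]

theorem form_mul_self_right (x y : V) : L.form (L.mul x y) y = 0 := by
  rw [L.form_mul, L.mul_self]; simp

theorem form_mul_self_outer (x y : V) : L.form (L.mul x y) x = 0 := by
  rw [L.form_mul, L.form_mul, L.mul_self]; simp

theorem form_isRefl : L.form.IsRefl := L.form_isAlt.isRefl

theorem eq_zero_of_form (x : V) (h : ∀ y, L.form x y = 0) : x = 0 :=
  L.form_nondegenerate.1 x h

/-- The orthogonal complement of a subspace with respect to the form. -/
def perp (A : Submodule F V) : Submodule F V := LinearMap.BilinForm.orthogonal L.form A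

theorem mem_perp {A : Submodule F V} {x : V} : x ∈ L.perp A ↔ ∀ a ∈ A, L.form x a = 0 := by
  unfold perp
  rw [LinearMap.BilinForm.mem_orthogonal_iff]
  refine forall₂_congr fun a _ => ?_
  show L.form a x = 0 ↔ _
  rw [L.form_swap x a, neg_eq_zero]

theorem perp_anti {A B : Submodule F V} (h : A ≤ B) : L.perp B ≤ L.perp A :=
  LinearMap.BilinForm.orthogonal_le h

theorem finrank_perp_add [FiniteDimensional F V] (A : Submodule F V) :
    Module.finrank F A + Module.finrank F (L.perp A) = Module.finrank F V := by
  unfold perp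
  rw [LinearMap.BilinForm.finrank_orthogonal L.form_nondegenerate]
  have := Submodule.finrank_le A
  omega

theorem perp_perp [FiniteDimensional F V] (A : Submodule F V) : L.perp (L.perp A) = A :=
  LinearMap.BilinForm.orthogonal_orthogonal L.form_nondegenerate L.form_isRefl A

theorem prod_le {A B C : Submodule F V} :
    L.prod A B ≤ C ↔ ∀ a ∈ A, ∀ b ∈ B, L.mul a b ∈ C := Submodule.map₂_le

theorem mul_mem_prod {A B : Submodule F V} {a b : V} (ha : a ∈ A) (hb : b ∈ B) :
    L.mul a b ∈ L.prod A B := Submodule.apply_mem_map₂ _ ha hb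

theorem mul_mem_power {k : ℕ} {x : V} (hx : x ∈ L.power k) (y : V) :
    L.mul x y ∈ L.power (k + 1) := by
  cases k with
  | zero => exact Submodule.mem_top
  | succ k => exact L.mul_mem_prod hx Submodule.mem_top

theorem power_succ_le (k : ℕ) : L.power (k + 1) ≤ L.power k := by
  induction k with
  | zero => exact le_top
  | succ k ih =>
    refine L.prod_le.2 fun a ha b _ => L.mul_mem_power (ih ha) b

theorem power_anti {k l : ℕ} (h : k ≤ l) : L.power l ≤ L.power k :=
  antitone_nat_of_succ_le L.power_succ_le h

theorem mul_mem_power_right {k : ℕ} {y : V} (hy : y ∈ L.power k) (x : V) :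
    L.mul x y ∈ L.power (k + 1) := by
  rw [L.mul_swap y x]; exact neg_mem (L.mul_mem_power hy x)

/-- Both sides say that (xb, a) vanishes for all a and b, because (ab, x) = (bx, a) = -(xb, a). -/
theorem mem_perp_prod {A B : Submodule F V} {x : V} :
    x ∈ L.perp (L.prod A B) ↔ ∀ b ∈ B, L.mul x b ∈ L.perp A := by
  constructor
  · intro h b hb
    refine L.mem_perp.2 fun a ha => ?_
    have := L.mem_perp.1 h _ (L.mul_mem_prod ha hb)
    rw [L.form_swap, L.form_mul, L.form_mul_swap_left x b a] at this
    simpa using this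
  · intro h
    rw [L.mem_perp]
    suffices L.prod A B ≤ L.perp (F ∙ x) by
      intro a ha
      have := L.mem_perp.1 (this ha) x (Submodule.mem_span_singleton_self x)
      rw [L.form_swap, this, neg_zero]
    refine L.prod_le.2 fun a ha b hb => L.mem_perp.2 fun c hc => ?_
    obtain ⟨t, rfl⟩ := Submodule.mem_span_singleton.1 hc
    have := L.mem_perp.1 (h b hb) a ha
    rw [map_smul, L.form_mul, L.form_mul_swap_left x b a, this]; simp

theorem mem_perp_power {k : ℕ} {x : V} :
    x ∈ L.perp (L.power (k + 2)) ↔ ∀ z, L.mul x z ∈ L.perp (L.power (k + 1)) := by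
  show x ∈ L.perp (L.prod (L.power (k + 1)) ⊤) ↔ _
  simp [L.mem_perp_prod]

theorem mem_centre {x : V} : x ∈ L.centre ↔ ∀ z, L.mul x z = 0 := by
  constructor
  · intro h z
    exact (Submodule.mem_bot F).1 (h.2 z Submodule.mem_top)
  · intro h
    exact ⟨Submodule.mem_top, fun y _ => (Submodule.mem_bot F).2 (h y)⟩

theorem perp_top : L.perp ⊤ = ⊥ := by
  rw [eq_bot_iff]
  intro x hx
  exact (Submodule.mem_bot F).2 (L.eq_zero_of_form x fun y => L.mem_perp.1 hx y Submodule.mem_top)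

theorem centre_eq : L.centre = L.perp (L.power 2) := by
  ext x
  rw [L.mem_centre, L.mem_perp_power]
  show _ ↔ ∀ z, L.mul x z ∈ L.perp ⊤
  simp [L.perp_top]

/-- The complement of L^(k+1) is the k-th centre, so this is the usual inclusion of the lower
central series in the upper one, by induction on k. -/
theorem power_le_perp {c : ℕ} (hc : L.power (c + 1) = ⊥) :
    ∀ k, k ≤ c → L.power (c + 1 - k) ≤ L.perp (L.power (k + 1)) := by
  intro k
  induction k with
  | zero => intro _; simp [hc]
  | succ k ih =>
    intro hk x hx
    rw [L.mem_perp_power]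
    intro z
    apply ih (by omega)
    have := L.mul_mem_power hx z
    rwa [show c + 1 - (k + 1) + 1 = c + 1 - k by omega] at this

theorem form_eq_zero_of_powers {c : ℕ} (hc : L.power (c + 1) = ⊥) {i j : ℕ} (hij : c + 2 ≤ i + j)
    {x y : V} (hx : x ∈ L.power i) (hy : y ∈ L.power j) : L.form x y = 0 := by
  rcases Nat.eq_zero_or_pos j with rfl | hj
  · have : L.power i ≤ L.power (c + 1) := L.power_anti (by omega)
    rw [hc] at this
    have := (Submodule.mem_bot F).1 (this hx)
    simp [this]
  · by_cases h : j ≤ c + 1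
    · have := L.power_le_perp hc (j - 1) (by omega) (L.power_anti (by omega) hx)
      rw [show j - 1 + 1 = j by omega] at this
      exact L.mem_perp.1 this y hy
    · have : L.power j ≤ L.power (c + 1) := L.power_anti (by omega)
      rw [hc] at this
      have := (Submodule.mem_bot F).1 (this hy)
      simp [this]

theorem power_stable {k : ℕ} (hk : L.power (k + 2) = L.power (k + 1)) (m : ℕ) :
    L.power (k + 1 + m) = L.power (k + 1) := by
  induction m with
  | zero => rfl
  | succ m ih =>
    rw [show k + 1 + (m + 1) = k + m + 2 by omega]
    show L.prod (L.power (k + m + 1)) ⊤ = _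
    rw [show k + m + 1 = k + 1 + m by omega, ih]; exact hk

theorem nilpotenceClass_spec {c : ℕ} (hL : L.IsNilpotent) (h : L.nilpotenceClass = c + 1) :
    L.power (c + 2) = ⊥ ∧ L.power (c + 1) ≠ ⊥ := by
  -- Nilpotency makes the set nonempty, which excludes the default value `sInf ∅ = 0`.
  have hmem : L.nilpotenceClass ∈ {c | L.power (c + 1) = ⊥} := Nat.sInf_mem hL
  refine ⟨by rw [h] at hmem; exact hmem, fun h0 => ?_⟩
  have : L.nilpotenceClass ≤ c := Nat.sInf_le h0
  omega

theorem nilpotenceClass_eq {c : ℕ} (h : L.power (c + 2) = ⊥) (h' : L.power (c + 1) ≠ ⊥) :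
    L.IsNilpotent ∧ L.nilpotenceClass = c + 1 := by
  refine ⟨⟨c + 1, h⟩, le_antisymm (Nat.sInf_le h) ?_⟩
  by_contra hlt
  have hmem : L.nilpotenceClass ∈ {c | L.power (c + 1) = ⊥} := Nat.sInf_mem ⟨c + 1, h⟩
  apply h'
  rw [eq_bot_iff, ← show L.power (L.nilpotenceClass + 1) = ⊥ from hmem]
  exact L.power_anti (by omega)

end Basic

/-! ### Dimensions of the lower central series -/

section Dimensions

variable (L : SAA F V)

theorem mem_sup_span_singleton {A : Submodule F V} {v x : V} :
    x ∈ A ⊔ (F ∙ v) ↔ ∃ a ∈ A, ∃ t : F, x = a + t • v := by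
  rw [Submodule.mem_sup]
  constructor
  · rintro ⟨a, ha, w, hw, rfl⟩
    obtain ⟨t, rfl⟩ := Submodule.mem_span_singleton.1 hw
    exact ⟨a, ha, t, rfl⟩
  · rintro ⟨a, ha, t, rfl⟩
    exact ⟨a, ha, _, Submodule.mem_span_singleton.2 ⟨t, rfl⟩, rfl⟩

theorem isotropic_sup_span_singleton {A : Submodule F V} (hA : A ≤ L.perp A) {v : V}
    (hv : v ∈ L.perp A) : A ⊔ (F ∙ v) ≤ L.perp (A ⊔ (F ∙ v)) := by
  intro x hx
  obtain ⟨a, ha, s, rfl⟩ := mem_sup_span_singleton.1 hx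
  rw [L.mem_perp]
  intro y hy
  obtain ⟨b, hb, t, rfl⟩ := mem_sup_span_singleton.1 hy
  have h1 := L.mem_perp.1 (hA ha) b hb
  have h2 := L.mem_perp.1 hv b hb
  have h3 := L.mem_perp.1 hv a ha
  rw [L.form_swap, neg_eq_zero] at h3
  have h4 : L.form v v = 0 := L.form_isAlt v
  simp [h1, h2, h3, h4]

theorem sup_span_singleton_eq [FiniteDimensional F V] {A B : Submodule F V} (hAB : A ≤ B)
    (h : Module.finrank F B = Module.finrank F A + 1) {v : V} (hv : v ∈ B) (hvA : v ∉ A) :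
    A ⊔ (F ∙ v) = B :=
  Submodule.eq_of_le_of_finrank_eq (sup_le hAB ((Submodule.span_singleton_le_iff_mem _ _).2 hv))
    (by rw [Submodule.finrank_sup_span_singleton hvA, h])

theorem exists_mem_notMem_of_finrank_lt [FiniteDimensional F V] {A B : Submodule F V}
    (h : Module.finrank F A < Module.finrank F B) : ∃ v ∈ B, v ∉ A := by
  by_contra hc
  push Not at hc
  have := Submodule.finrank_mono (show B ≤ A from hc)
  omega

/-- The product induces an alternating map on the plane L/L^2 with values in L^2/L^3. Such a map is
a multiple of the determinant, so its value at v and any complementary b spans the image. -/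
theorem power_two_le_of_notMem [FiniteDimensional F V]
    (h : Module.finrank F V = Module.finrank F (L.power 2) + 2) {v : V} (hv : v ∉ L.power 2) :
    ∃ b, L.power 2 ≤ L.power 3 ⊔ (F ∙ L.mul v b) := by
  have h1 := Submodule.finrank_sup_span_singleton hv
  obtain ⟨b, -, hb⟩ := exists_mem_notMem_of_finrank_lt (A := L.power 2 ⊔ (F ∙ v)) (B := ⊤)
    (by rw [h1, finrank_top]; omega)
  have htop := sup_span_singleton_eq le_top (by rw [h1, finrank_top]; omega) Submodule.mem_top hb
  refine ⟨b, L.prod_le.2 fun x _ y _ => ?_⟩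
  have hx : x ∈ (L.power 2 ⊔ (F ∙ v)) ⊔ (F ∙ b) := by rw [htop]; exact Submodule.mem_top
  have hy : y ∈ (L.power 2 ⊔ (F ∙ v)) ⊔ (F ∙ b) := by rw [htop]; exact Submodule.mem_top
  obtain ⟨x', hx', s, rfl⟩ := mem_sup_span_singleton.1 hx
  obtain ⟨y', hy', s', rfl⟩ := mem_sup_span_singleton.1 hy
  obtain ⟨l, hl, t, rfl⟩ := mem_sup_span_singleton.1 hx'
  obtain ⟨m, hm, t', rfl⟩ := mem_sup_span_singleton.1 hy'
  refine mem_sup_span_singleton.2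
    ⟨L.mul l (m + t' • v + s' • b) + L.mul (t • v + s • b) m,
      add_mem (L.mul_mem_power hl _) (L.mul_mem_power_right hm _), t * s' - s * t', ?_⟩
  simp only [map_add, map_smul, LinearMap.add_apply, LinearMap.smul_apply, L.mul_self,
    L.mul_swap v b]
  module

theorem power_lt {c : ℕ} (hc : L.power (c + 1) = ⊥) (hc' : L.power c ≠ ⊥) {k : ℕ} (hk : k < c) :
    L.power (k + 2) < L.power (k + 1) := by
  refine lt_of_le_of_ne (L.power_succ_le _) fun h => hc' ?_
  have h1 := L.power_stable h (c - (k + 1))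
  have h2 := L.power_stable h (c - k)
  rw [show k + 1 + (c - (k + 1)) = c by omega] at h1
  rw [show k + 1 + (c - k) = c + 1 by omega] at h2
  rw [h1, ← h2, hc]

/-- If L^(k+1) lay in the m-th centre, multiplying m times by L would give L^(k+m+1) = 0. This is
the converse of `power_le_perp` and the source of every non-inclusion below. -/
theorem notMem_perp_of_power_ne {k : ℕ} : ∀ {m : ℕ}, L.power (k + m + 1) ≠ ⊥ →
    ¬ L.power (k + 1) ≤ L.perp (L.power (m + 1)) := by
  intro m
  induction m generalizing k with
  | zero =>
    intro h h'
    refine h (eq_bot_iff.2 (h'.trans ?_))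
    show L.perp ⊤ ≤ ⊥
    rw [L.perp_top]
  | succ m ih =>
    intro h h'
    refine ih (k := k + 1) (by rwa [show k + 1 + m + 1 = k + (m + 1) + 1 by omega]) ?_
    refine L.prod_le.2 fun x hx y _ => L.mem_perp_power.1 (h' hx) y

/-- The dimensions of the lower central series and its duality with the upper central series. -/
structure HasMaximalDims : Prop where
  power_eight : L.power 8 = ⊥
  power_seven_ne : L.power 7 ≠ ⊥
  dim : Module.finrank F V = 10
  dim_two : Module.finrank F (L.power 2) = 8
  dim_three : Module.finrank F (L.power 3) = 7
  dim_four : Module.finrank F (L.power 4) = 6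
  dim_five : Module.finrank F (L.power 5) = 4
  dim_six : Module.finrank F (L.power 6) = 3
  dim_seven : Module.finrank F (L.power 7) = 2

/-- Duality gives dim L^2 = 8, and two generators give dim L^2/L^3 = 1. Once L^7 is known to be the
whole centre, strict descent and the bounds dim L^6 ≤ 10 - dim L^3 and dim L^5 ≤ 10 - dim L^4 leave
only dim L^4 = 5 to be excluded. -/
theorem hasMaximalDims (hdim : Module.finrank F V = 10) (h8 : L.power 8 = ⊥)
    (h7 : L.power 7 ≠ ⊥) (hZ : Module.finrank F L.centre = 2) : L.HasMaximalDims := by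
  have : FiniteDimensional F V := FiniteDimensional.of_finrank_pos (by omega)
  have e1 := L.finrank_perp_add (L.power 2)
  have e2 := L.finrank_perp_add (L.power 3)
  have e3 := L.finrank_perp_add (L.power 4)
  have lt : ∀ k < 7, Module.finrank F (L.power (k + 2)) < Module.finrank F (L.power (k + 1)) :=
    fun k hk => Submodule.finrank_lt_finrank_of_lt (L.power_lt h8 h7 hk)
  have d2 : Module.finrank F (L.power 2) = 8 := by rw [← L.centre_eq] at e1; omega
  have dperp2 : Module.finrank F (L.perp (L.power 2)) = 2 := by omega
  have d3 : Module.finrank F (L.power 3) = 7 := by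
    obtain ⟨v, -, hv⟩ := exists_mem_notMem_of_finrank_lt (A := L.power 2) (B := ⊤)
      (by rw [finrank_top]; omega)
    obtain ⟨b, hb⟩ := L.power_two_le_of_notMem (by omega) hv
    have h1 := Submodule.finrank_mono hb
    have h2 : Module.finrank F ↥(L.power 3 ⊔ (F ∙ L.mul v b)) ≤
        Module.finrank F (L.power 3) + 1 := by
      by_cases hm : L.mul v b ∈ L.power 3
      · rw [sup_eq_left.2 ((Submodule.span_singleton_le_iff_mem _ _).2 hm)]; omega
      · exact (Submodule.finrank_sup_span_singleton hm).le
    have h4 := lt 1 (by omega)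
    simp only [Nat.reduceAdd] at h4
    omega
  -- `Z` and `L⁶` together span the second centre
  have hsup : L.perp (L.power 2) ⊔ L.power 6 = L.perp (L.power 3) := by
    have hle : L.perp (L.power 2) ⊔ L.power 6 ≤ L.perp (L.power 3) :=
      sup_le (L.perp_anti (L.power_succ_le 2)) (L.power_le_perp h8 2 (by omega))
    refine Submodule.eq_of_le_of_finrank_le hle ?_
    have : L.perp (L.power 2) < L.perp (L.power 2) ⊔ L.power 6 :=
      left_lt_sup.2 (L.notMem_perp_of_power_ne (k := 5) (m := 1) h7)
    have := Submodule.finrank_lt_finrank_of_lt this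
    omega
  -- Dually, the complement of L^7 must lie in L^2. For v in it, vL is orthogonal both to Z and to
  -- L^6, hence lies in L^3; outside L^2 this would force L^2 = L^3.
  have h7eq : L.power 7 = L.perp (L.power 2) := by
    refine le_antisymm (L.power_le_perp h8 1 (by omega)) ?_
    rw [← L.perp_perp (L.power 7)]
    refine L.perp_anti fun v hv => ?_
    have hmul : ∀ z, L.mul v z ∈ L.power 3 := by
      intro z
      rw [← L.perp_perp (L.power 3), ← hsup, L.mem_perp]
      intro a ha
      obtain ⟨c, hc, d, hd, rfl⟩ := Submodule.mem_sup.1 ha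
      have h1 : L.form (L.mul v z) c = 0 := by
        rw [L.form_swap, neg_eq_zero]
        exact L.mem_perp.1 hc _ (L.mul_mem_prod (A := ⊤) Submodule.mem_top Submodule.mem_top)
      have h2 := L.mem_perp.1 (L.mem_perp_power.1 hv z) d hd
      rw [map_add, h1, h2, add_zero]
    by_contra hv2
    obtain ⟨b, hb⟩ := L.power_two_le_of_notMem (by omega) hv2
    have : L.power 2 ≤ L.power 3 :=
      hb.trans (sup_le le_rfl ((Submodule.span_singleton_le_iff_mem _ _).2 (hmul b)))
    have := Submodule.finrank_mono this
    omega
  have d7 : Module.finrank F (L.power 7) = 2 := by rw [h7eq, dperp2]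
  have l6 := Submodule.finrank_mono (L.power_le_perp h8 2 (by omega))
  have l5 := Submodule.finrank_mono (L.power_le_perp h8 3 (by omega))
  have l7 := lt 5 (by omega)
  have l65 := lt 4 (by omega)
  have l54 := lt 3 (by omega)
  simp only [Nat.reduceAdd, Nat.reduceSub] at l5 l6 l7 l65 l54
  -- Otherwise L^4 is L^5 plus one vector and L^5 is orthogonal to L^4, so L^4 is isotropic, which
  -- forces L^7 = 0.
  have d4 : Module.finrank F (L.power 4) ≠ 5 := by
    intro d4
    obtain ⟨v, hv, hv'⟩ := exists_mem_notMem_of_finrank_lt l54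
    have hs := sup_span_singleton_eq (L.power_succ_le 4) (by simp only [Nat.reduceAdd]; omega) hv
        hv'
    have h5 : L.power 5 ≤ L.perp (L.power 4) := L.power_le_perp h8 3 (by omega)
    have := L.isotropic_sup_span_singleton (A := L.power 5)
      (h5.trans (L.perp_anti (L.power_succ_le 4))) (v := v) (by
        rw [L.mem_perp]
        intro a ha
        rw [L.form_swap, L.mem_perp.1 (h5 ha) v hv, neg_zero])
    rw [hs] at this
    exact L.notMem_perp_of_power_ne (k := 3) (m := 3) h7 this
  exact ⟨h8, h7, hdim, d2, d3, by omega, by omega, by omega, d7⟩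

variable {L}

theorem HasMaximalDims.perp_power (h : L.HasMaximalDims) :
    L.perp (L.power 2) = L.power 7 ∧ L.perp (L.power 3) = L.power 6 ∧
      L.perp (L.power 4) = L.power 5 := by
  have : FiniteDimensional F V := FiniteDimensional.of_finrank_pos (by have := h.dim; omega)
  obtain ⟨h8, -, d, d2, d3, d4, d5, d6, d7⟩ := h
  have e1 := L.finrank_perp_add (L.power 2)
  have e2 := L.finrank_perp_add (L.power 3)
  have e3 := L.finrank_perp_add (L.power 4)
  exact ⟨(Submodule.eq_of_le_of_finrank_eq (L.power_le_perp h8 1 (by omega)) (by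
      simp only [Nat.reduceAdd, Nat.reduceSub]; omega)).symm,
    (Submodule.eq_of_le_of_finrank_eq (L.power_le_perp h8 2 (by omega)) (by
      simp only [Nat.reduceAdd, Nat.reduceSub]; omega)).symm,
    (Submodule.eq_of_le_of_finrank_eq (L.power_le_perp h8 3 (by omega)) (by
      simp only [Nat.reduceAdd, Nat.reduceSub]; omega)).symm⟩

end Dimensions

/-! ### Frames and the symplectic moves that preserve them -/

section Frames

/-- Two families `x`, `y` that satisfy the relations common to all nilpotent presentations. -/
structure IsFrame (L : SAA F V) {n : ℕ} (x y : Fin n → V) : Prop where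
  form_xx : ∀ i j, L.form (x i) (x j) = 0
  form_yy : ∀ i j, L.form (y i) (y j) = 0
  form_xy : ∀ i j, L.form (x i) (y j) = if i = j then 1 else 0
  mul_xx : ∀ i j, L.mul (x i) (x j) = 0
  mul_xy : ∀ i j, j ≤ i → L.mul (x i) (y j) = 0

namespace IsFrame

variable {L : SAA F V} {n : ℕ} {x y : Fin n → V}

theorem form_yx (h : L.IsFrame x y) (i j : Fin n) :
    L.form (y i) (x j) = if i = j then -1 else 0 := by
  rw [L.form_swap, h.form_xy]
  rcases eq_or_ne i j with rfl | hij
  · simp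
  · simp [hij, hij.symm]

/-- The direction i < j matters: an x only receives an x of higher index and a y only a y of lower
index, so the vanishing of x_k y_l for l ≤ k survives. -/
theorem shear (h : L.IsFrame x y) {i j : Fin n} (hij : i < j) (a : F) :
    L.IsFrame (Function.update x i (x i - a • x j)) (Function.update y j (y j + a • y i)) := by
  refine ⟨fun k l => ?_, fun k l => ?_, fun k l => ?_, fun k l => ?_, fun k l hkl => ?_⟩
  · simp only [Function.update_apply]
    split_ifs <;> simp [h.form_xx]
  · simp only [Function.update_apply]
    split_ifs <;> simp [h.form_yy]
  · simp only [Function.update_apply]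
    have := hij.ne
    split_ifs <;> subst_vars <;> simp_all [h.form_xy] <;>
      simp_all [eq_comm]
  · simp only [Function.update_apply]
    split_ifs <;> simp [h.mul_xx]
  · simp only [Function.update_apply]
    split_ifs with h1 h2 h2
    · subst h1 h2; exact absurd hij (not_lt.2 hkl)
    · subst h1; simp [h.mul_xy _ _ hkl, h.mul_xy _ _ (hkl.trans hij.le)]
    · subst h2; simp [h.mul_xy _ _ hkl, h.mul_xy _ _ (hij.le.trans hkl)]
    · exact h.mul_xy _ _ hkl

theorem shift_self (h : L.IsFrame x y) (i : Fin n) (a : F) :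
    L.IsFrame x (Function.update y i (y i + a • x i)) := by
  refine ⟨h.form_xx, fun k l => ?_, fun k l => ?_, h.mul_xx, fun k l hkl => ?_⟩
  · simp only [Function.update_apply]
    split_ifs <;> subst_vars <;>
      simp_all [h.form_yy, h.form_xy, h.form_yx, h.form_xx] <;> simp_all [eq_comm]
  · simp only [Function.update_apply]
    split_ifs <;> subst_vars <;> simp_all [h.form_xy, h.form_xx]
  · simp only [Function.update_apply]
    split_ifs <;> subst_vars <;> simp [h.mul_xy _ _ hkl, h.mul_xx]

/-- Adding x's to y's is harmless for the products x_k y_l since all x_k x_l vanish; the symmetric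
pair of corrections keeps (y_i, y_j) = 0. -/
theorem shift (h : L.IsFrame x y) {i j : Fin n} (hij : i ≠ j) (a : F) :
    L.IsFrame x (Function.update (Function.update y i (y i + a • x j)) j (y j + a • x i)) := by
  refine ⟨h.form_xx, fun k l => ?_, fun k l => ?_, h.mul_xx, fun k l hkl => ?_⟩
  · simp only [Function.update_apply]
    have := hij.symm
    split_ifs <;> subst_vars <;>
      simp_all [h.form_yy, h.form_xy, h.form_yx, h.form_xx] <;> simp_all [eq_comm]
  · simp only [Function.update_apply]
    split_ifs <;> subst_vars <;> simp_all [h.form_xy, h.form_xx]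
  · simp only [Function.update_apply]
    split_ifs <;> subst_vars <;> simp [h.mul_xy _ _ hkl, h.mul_xx]

theorem scale (h : L.IsFrame x y) (c : Fin n → Fˣ) :
    L.IsFrame (fun i => (c i : F)⁻¹ • x i) (fun i => (c i : F) • y i) := by
  refine ⟨fun k l => ?_, fun k l => ?_, fun k l => ?_, fun k l => ?_, fun k l hkl => ?_⟩
  · simp [h.form_xx]
  · simp [h.form_yy]
  · rcases eq_or_ne k l with rfl | hkl <;> simp [h.form_xy, *]
  · simp [h.mul_xx]
  · simp [h.mul_xy _ _ hkl]

theorem mul_yx (_ : L.IsFrame x y) (i j : Fin n) : L.mul (y i) (x j) = -L.mul (x j) (y i) :=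
  L.mul_swap _ _

theorem mul_yy (_ : L.IsFrame x y) (i j : Fin n) (_ : i < j) :
    L.mul (y j) (y i) = -L.mul (y i) (y j) :=
  L.mul_swap _ _

theorem form_yyx (_ : L.IsFrame x y) (i j k : Fin n) :
    L.form (L.mul (y i) (y j)) (x k) = L.form (L.mul (x k) (y i)) (y j) := by
  rw [L.form_mul, L.form_mul]

theorem form_xyx (h : L.IsFrame x y) (i j k : Fin n) :
    L.form (L.mul (x i) (y j)) (x k) = 0 := by
  rw [L.form_mul_swap_right, h.mul_xx]; simp

theorem form_xyy (_ : L.IsFrame x y) (i j k : Fin n) (_ : j < k) :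
    L.form (L.mul (x i) (y k)) (y j) = -L.form (L.mul (x i) (y j)) (y k) :=
  L.form_mul_swap_right _ _ _

theorem form_yyy (_ : L.IsFrame x y) (i j k : Fin n) (_ : j < k) :
    L.form (L.mul (y i) (y k)) (y j) = -L.form (L.mul (y i) (y j)) (y k) :=
  L.form_mul_swap_right _ _ _

theorem form_xyy_of_le (h : L.IsFrame x y) (i j k : Fin n) (hki : k ≤ i) :
    L.form (L.mul (x i) (y j)) (y k) = 0 := by
  rw [L.form_mul_swap_right, h.mul_xy _ _ hki]; simp

theorem linearIndependent (h : L.IsFrame x y) : LinearIndependent F (Sum.elim x y) := by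
  rw [Fintype.linearIndependent_iff]
  intro g hg
  have key : ∀ v, L.form (∑ i, g (Sum.inl i) • x i + ∑ i, g (Sum.inr i) • y i) v = 0 := by
    intro v
    rw [Fintype.sum_sum_type] at hg
    simp only [Sum.elim_inl, Sum.elim_inr] at hg
    rw [hg]; simp
  rintro (i | i)
  · simpa [h.form_xy, h.form_yy] using key (y i)
  · simpa [h.form_xx, h.form_yx] using key (x i)

theorem exists_basis [NeZero n] (h : L.IsFrame x y) (hdim : Module.finrank F V = n + n) :
    ∃ b : Module.Basis (Fin n ⊕ Fin n) F V,
      (∀ i, b (Sum.inl i) = x i) ∧ ∀ i, b (Sum.inr i) = y i := by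
  exact ⟨basisOfLinearIndependentOfCardEqFinrank h.linearIndependent (by simp [hdim]),
    fun i => by simp, fun i => by simp⟩

end IsFrame
end Frames

/-! ### Clearing the remaining triple values -/

section Normalisation

/-- Rewriting rules that let `simp` reduce a triple value to the ones with increasing indices; the
strict inequalities prevent the swaps from looping. -/
theorem IsFrame.rules {L : SAA F V} {n : ℕ} {x y : Fin n → V} (h : L.IsFrame x y) :
    (∀ i j, L.mul (x i) (x j) = 0) ∧ (∀ i j, j ≤ i → L.mul (x i) (y j) = 0) ∧
    (∀ i j, L.mul (y i) (x j) = -L.mul (x j) (y i)) ∧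
    (∀ i j, i < j → L.mul (y j) (y i) = -L.mul (y i) (y j)) ∧
    (∀ i j k, L.form (L.mul (y i) (y j)) (x k) = L.form (L.mul (x k) (y i)) (y j)) ∧
    (∀ i j k, L.form (L.mul (x i) (y j)) (x k) = 0) ∧
    (∀ i j k, k ≤ i → L.form (L.mul (x i) (y j)) (y k) = 0) ∧
    (∀ i j k, j < k → L.form (L.mul (x i) (y k)) (y j) = -L.form (L.mul (x i) (y j)) (y k)) ∧
    (∀ i j k, j < k → L.form (L.mul (y i) (y k)) (y j) = -L.form (L.mul (y i) (y j)) (y k)) ∧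
    (∀ v w, L.form (L.mul v w) w = 0) ∧ (∀ v w, L.form (L.mul v w) v = 0) ∧
    (∀ v, L.mul v v = 0) :=
  ⟨h.mul_xx, h.mul_xy, h.mul_yx, h.mul_yy, h.form_yyx, h.form_xyx, h.form_xyy_of_le,
    h.form_xyy, h.form_yyy, L.form_mul_self_right, L.form_mul_self_outer, L.mul_self⟩

/-- A frame in dimension ten in which the leading triple values are those of the presentation
`presentation24 r` and in which the flag conditions hold. -/
structure IsNormalFrame (L : SAA F V) (x y : Fin 5 → V) (r : F) : Prop extends
    L.IsFrame x y where
  x345 : L.form (L.mul (x 2) (y 3)) (y 4) = r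
  x235 : L.form (L.mul (x 1) (y 2)) (y 4) = 1
  x125 : L.form (L.mul (x 0) (y 1)) (y 4) = 1
  x134 : L.form (L.mul (x 0) (y 2)) (y 3) = 1
  y124 : L.form (L.mul (y 0) (y 1)) (y 3) = 1
  x234 : L.form (L.mul (x 1) (y 2)) (y 3) = 0
  x123 : L.form (L.mul (x 0) (y 1)) (y 2) = 0
  x124 : L.form (L.mul (x 0) (y 1)) (y 3) = 0
  y123 : L.form (L.mul (y 0) (y 1)) (y 2) = 0

theorem IsNormalFrame.values {L : SAA F V} {x y : Fin 5 → V} {r : F}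
    (h : L.IsNormalFrame x y r) :
    L.form (L.mul (x 2) (y 3)) (y 4) = r ∧ L.form (L.mul (x 1) (y 2)) (y 4) = 1 ∧
    L.form (L.mul (x 0) (y 1)) (y 4) = 1 ∧ L.form (L.mul (x 0) (y 2)) (y 3) = 1 ∧
    L.form (L.mul (y 0) (y 1)) (y 3) = 1 ∧ L.form (L.mul (x 1) (y 2)) (y 3) = 0 ∧
    L.form (L.mul (x 0) (y 1)) (y 2) = 0 ∧ L.form (L.mul (x 0) (y 1)) (y 3) = 0 ∧
    L.form (L.mul (y 0) (y 1)) (y 2) = 0 :=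
  ⟨h.x345, h.x235, h.x125, h.x134, h.y124, h.x234, h.x123, h.x124, h.y123⟩

set_option maxHeartbeats 4000000 in
/-- The remaining triple values of a normal frame are eliminated one after the other by symplectic
transvections. -/
theorem IsNormalFrame.exists_reduced {L : SAA F V} {x y : Fin 5 → V} {r : F}
    (h : L.IsNormalFrame x y r) :
    ∃ x y : Fin 5 → V, L.IsNormalFrame x y r ∧
      L.form (L.mul (y 0) (y 2)) (y 3) = 0 ∧
      L.form (L.mul (y 0) (y 1)) (y 4) = 0 ∧
      L.form (L.mul (x 0) (y 2)) (y 4) = 0 ∧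
      L.form (L.mul (x 1) (y 3)) (y 4) = 0 ∧
      L.form (L.mul (y 0) (y 2)) (y 4) = 0 ∧
      L.form (L.mul (y 1) (y 2)) (y 3) = 0 ∧
      L.form (L.mul (x 0) (y 3)) (y 4) = 0 ∧
      L.form (L.mul (y 0) (y 3)) (y 4) = 0 ∧
      L.form (L.mul (y 1) (y 2)) (y 4) = 0 ∧
      L.form (L.mul (y 1) (y 3)) (y 4) = 0 ∧
      L.form (L.mul (y 2) (y 3)) (y 4) = 0 := by
  -- Each move changes its target value by ±a times one of the pivots (x_2 y_3, y_5), (x_1 y_3,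
  -- y_4), (y_1 y_2, y_4), all equal to 1, which dictates the coefficient. The order is chosen so
  -- that a move keeps the nine normalised values and the zeros already obtained; r stays unchanged.
  obtain ⟨x, y, h, hb134⟩ : ∃ x y : Fin 5 → V, L.IsNormalFrame x y r ∧
      L.form (L.mul (y 0) (y 2)) (y 3) = 0 := by
    refine ⟨_, _, ⟨h.shift_self 0 (-L.form (L.mul (y 0) (y 2)) (y 3)), ?_, ?_, ?_, ?_, ?_, ?_, ?_,
        ?_, ?_⟩, ?_⟩ <;>
      simp [h.values]
  obtain ⟨x, y, h, hb134, hb125⟩ : ∃ x y : Fin 5 → V, L.IsNormalFrame x y r ∧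
      L.form (L.mul (y 0) (y 2)) (y 3) = 0 ∧
      L.form (L.mul (y 0) (y 1)) (y 4) = 0 := by
    refine ⟨_, _, ⟨h.shear (i := 3) (j := 4) (by decide) (-L.form (L.mul (y 0) (y 1)) (y 4)), ?_,
        ?_, ?_, ?_, ?_, ?_, ?_, ?_, ?_⟩, ?_, ?_⟩ <;>
      simp [h.rules, h.values, hb134]
  obtain ⟨x, y, h, hb134, hb125, hA2⟩ : ∃ x y : Fin 5 → V, L.IsNormalFrame x y r ∧
      L.form (L.mul (y 0) (y 2)) (y 3) = 0 ∧
      L.form (L.mul (y 0) (y 1)) (y 4) = 0 ∧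
      L.form (L.mul (x 0) (y 2)) (y 4) = 0 := by
    refine ⟨_, _, ⟨h.shear (i := 0) (j := 1) (by decide) (L.form (L.mul (x 0) (y 2)) (y 4)), ?_,
        ?_, ?_, ?_, ?_, ?_, ?_, ?_, ?_⟩, ?_, ?_, ?_⟩ <;>
      simp [h.rules, h.values, hb134, hb125]
  obtain ⟨x, y, h, hb134, hb125, hA2, hA1⟩ : ∃ x y : Fin 5 → V, L.IsNormalFrame x y r ∧
      L.form (L.mul (y 0) (y 2)) (y 3) = 0 ∧
      L.form (L.mul (y 0) (y 1)) (y 4) = 0 ∧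
      L.form (L.mul (x 0) (y 2)) (y 4) = 0 ∧
      L.form (L.mul (x 1) (y 3)) (y 4) = 0 := by
    refine ⟨_, _, ⟨h.shear (i := 2) (j := 3) (by decide) (-L.form (L.mul (x 1) (y 3)) (y 4)), ?_,
        ?_, ?_, ?_, ?_, ?_, ?_, ?_, ?_⟩, ?_, ?_, ?_, ?_⟩ <;>
      simp [h.rules, h.values, hb134, hb125, hA2]
  obtain ⟨x, y, h, hb134, hb125, hA2, hA1, hb135⟩ : ∃ x y : Fin 5 → V, L.IsNormalFrame x y r ∧
      L.form (L.mul (y 0) (y 2)) (y 3) = 0 ∧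
      L.form (L.mul (y 0) (y 1)) (y 4) = 0 ∧
      L.form (L.mul (x 0) (y 2)) (y 4) = 0 ∧
      L.form (L.mul (x 1) (y 3)) (y 4) = 0 ∧
      L.form (L.mul (y 0) (y 2)) (y 4) = 0 := by
    refine ⟨_, _, ⟨h.shift (i := 0) (j := 1) (by decide) (-L.form (L.mul (y 0) (y 2)) (y 4)), ?_,
        ?_, ?_, ?_, ?_, ?_, ?_, ?_, ?_⟩, ?_, ?_, ?_, ?_, ?_⟩ <;>
      simp [h.rules, h.values, hb134, hb125, hA2, hA1]
  obtain ⟨x, y, h, hb134, hb125, hA2, hA1, hb135, hb234⟩ : ∃ x y : Fin 5 → V, L.IsNormalFrame x y r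
      ∧
      L.form (L.mul (y 0) (y 2)) (y 3) = 0 ∧
      L.form (L.mul (y 0) (y 1)) (y 4) = 0 ∧
      L.form (L.mul (x 0) (y 2)) (y 4) = 0 ∧
      L.form (L.mul (x 1) (y 3)) (y 4) = 0 ∧
      L.form (L.mul (y 0) (y 2)) (y 4) = 0 ∧
      L.form (L.mul (y 1) (y 2)) (y 3) = 0 := by
    refine ⟨_, _, ⟨h.shear (i := 0) (j := 2) (by decide) (L.form (L.mul (y 1) (y 2)) (y 3)), ?_,
        ?_, ?_, ?_, ?_, ?_, ?_, ?_, ?_⟩, ?_, ?_, ?_, ?_, ?_, ?_⟩ <;>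
      simp [h.rules, h.values, hb134, hb125, hA2, hA1, hb135]
  obtain ⟨x, y, h, hb134, hb125, hA2, hA1, hb135, hb234, hA3⟩ : ∃ x y : Fin 5 → V, L.IsNormalFrame
      x y r ∧
      L.form (L.mul (y 0) (y 2)) (y 3) = 0 ∧
      L.form (L.mul (y 0) (y 1)) (y 4) = 0 ∧
      L.form (L.mul (x 0) (y 2)) (y 4) = 0 ∧
      L.form (L.mul (x 1) (y 3)) (y 4) = 0 ∧
      L.form (L.mul (y 0) (y 2)) (y 4) = 0 ∧
      L.form (L.mul (y 1) (y 2)) (y 3) = 0 ∧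
      L.form (L.mul (x 0) (y 3)) (y 4) = 0 := by
    refine ⟨_, _, ⟨h.shear (i := 2) (j := 4) (by decide) (L.form (L.mul (x 0) (y 3)) (y 4)), ?_,
        ?_, ?_, ?_, ?_, ?_, ?_, ?_, ?_⟩, ?_, ?_, ?_, ?_, ?_, ?_, ?_⟩ <;>
      simp [h.rules, h.values, hb134, hb125, hA2, hA1, hb135, hb234]
  obtain ⟨x, y, h, hb134, hb125, hA2, hA1, hb135, hb234, hA3, hb145⟩ : ∃ x y : Fin 5 → V,
      L.IsNormalFrame x y r ∧
      L.form (L.mul (y 0) (y 2)) (y 3) = 0 ∧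
      L.form (L.mul (y 0) (y 1)) (y 4) = 0 ∧
      L.form (L.mul (x 0) (y 2)) (y 4) = 0 ∧
      L.form (L.mul (x 1) (y 3)) (y 4) = 0 ∧
      L.form (L.mul (y 0) (y 2)) (y 4) = 0 ∧
      L.form (L.mul (y 1) (y 2)) (y 3) = 0 ∧
      L.form (L.mul (x 0) (y 3)) (y 4) = 0 ∧
      L.form (L.mul (y 0) (y 3)) (y 4) = 0 := by
    refine ⟨_, _, ⟨h.shear (i := 1) (j := 4) (by decide) (L.form (L.mul (y 0) (y 3)) (y 4)), ?_,
        ?_, ?_, ?_, ?_, ?_, ?_, ?_, ?_⟩, ?_, ?_, ?_, ?_, ?_, ?_, ?_, ?_⟩ <;>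
      simp [h.rules, h.values, hb134, hb125, hA2, hA1, hb135, hb234, hA3]
  obtain ⟨x, y, h, hb134, hb125, hA2, hA1, hb135, hb234, hA3, hb145, hb235⟩ : ∃ x y : Fin 5 → V,
      L.IsNormalFrame x y r ∧
      L.form (L.mul (y 0) (y 2)) (y 3) = 0 ∧
      L.form (L.mul (y 0) (y 1)) (y 4) = 0 ∧
      L.form (L.mul (x 0) (y 2)) (y 4) = 0 ∧
      L.form (L.mul (x 1) (y 3)) (y 4) = 0 ∧
      L.form (L.mul (y 0) (y 2)) (y 4) = 0 ∧
      L.form (L.mul (y 1) (y 2)) (y 3) = 0 ∧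
      L.form (L.mul (x 0) (y 3)) (y 4) = 0 ∧
      L.form (L.mul (y 0) (y 3)) (y 4) = 0 ∧
      L.form (L.mul (y 1) (y 2)) (y 4) = 0 := by
    refine ⟨_, _, ⟨h.shift_self 1 (-L.form (L.mul (y 1) (y 2)) (y 4)), ?_, ?_, ?_, ?_, ?_, ?_, ?_,
        ?_, ?_⟩, ?_, ?_, ?_, ?_, ?_, ?_, ?_, ?_, ?_⟩ <;>
      simp [h.rules, h.values, hb134, hb125, hA2, hA1, hb135, hb234, hA3, hb145]
  obtain ⟨x, y, h, hb134, hb125, hA2, hA1, hb135, hb234, hA3, hb145, hb235, hb245⟩ : ∃ x y : Fin 5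
      → V, L.IsNormalFrame x y r ∧
      L.form (L.mul (y 0) (y 2)) (y 3) = 0 ∧
      L.form (L.mul (y 0) (y 1)) (y 4) = 0 ∧
      L.form (L.mul (x 0) (y 2)) (y 4) = 0 ∧
      L.form (L.mul (x 1) (y 3)) (y 4) = 0 ∧
      L.form (L.mul (y 0) (y 2)) (y 4) = 0 ∧
      L.form (L.mul (y 1) (y 2)) (y 3) = 0 ∧
      L.form (L.mul (x 0) (y 3)) (y 4) = 0 ∧
      L.form (L.mul (y 0) (y 3)) (y 4) = 0 ∧
      L.form (L.mul (y 1) (y 2)) (y 4) = 0 ∧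
      L.form (L.mul (y 1) (y 3)) (y 4) = 0 := by
    refine ⟨_, _, ⟨h.shear (i := 0) (j := 4) (by decide) (-L.form (L.mul (y 1) (y 3)) (y 4)), ?_,
        ?_, ?_, ?_, ?_, ?_, ?_, ?_, ?_⟩, ?_, ?_, ?_, ?_, ?_, ?_, ?_, ?_, ?_, ?_⟩ <;>
      simp [h.rules, h.values, hb134, hb125, hA2, hA1, hb135, hb234, hA3, hb145, hb235]
  obtain ⟨x, y, h, hb134, hb125, hA2, hA1, hb135, hb234, hA3, hb145, hb235, hb245, hb345⟩ : ∃ x y :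
      Fin 5 → V, L.IsNormalFrame x y r ∧
      L.form (L.mul (y 0) (y 2)) (y 3) = 0 ∧
      L.form (L.mul (y 0) (y 1)) (y 4) = 0 ∧
      L.form (L.mul (x 0) (y 2)) (y 4) = 0 ∧
      L.form (L.mul (x 1) (y 3)) (y 4) = 0 ∧
      L.form (L.mul (y 0) (y 2)) (y 4) = 0 ∧
      L.form (L.mul (y 1) (y 2)) (y 3) = 0 ∧
      L.form (L.mul (x 0) (y 3)) (y 4) = 0 ∧
      L.form (L.mul (y 0) (y 3)) (y 4) = 0 ∧
      L.form (L.mul (y 1) (y 2)) (y 4) = 0 ∧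
      L.form (L.mul (y 1) (y 3)) (y 4) = 0 ∧
      L.form (L.mul (y 2) (y 3)) (y 4) = 0 := by
    refine ⟨_, _, ⟨h.shift (i := 0) (j := 4) (by decide) (-L.form (L.mul (y 2) (y 3)) (y 4)), ?_,
        ?_, ?_, ?_, ?_, ?_, ?_, ?_, ?_⟩, ?_, ?_, ?_, ?_, ?_, ?_, ?_, ?_, ?_, ?_, ?_⟩ <;>
      simp [h.rules, h.values, hb134, hb125, hA2, hA1, hb135, hb234, hA3, hb145, hb235, hb245]
  exact ⟨x, y, h, hb134, hb125, hA2, hA1, hb135, hb234, hA3, hb145, hb235, hb245, hb345⟩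

end Normalisation

/-! ### Dual families, expansions and rescaling -/

section Existence

variable (L : SAA F V)

/-- The map v ↦ ((x_i, v))_i is onto: a functional vanishing on its range would give a linear
combination of the x_i orthogonal to all of V. -/
theorem exists_dual_family {n : ℕ} {x : Fin n → V} (hx : LinearIndependent F x) :
    ∃ z : Fin n → V, ∀ i j, L.form (x i) (z j) = if i = j then 1 else 0 := by
  let T : V →ₗ[F] (Fin n → F) := LinearMap.pi fun i => L.form (x i)
  have hT : LinearMap.range T = ⊤ := by
    by_contra hne
    obtain ⟨f, hf0, hf⟩ := Submodule.exists_le_ker_of_lt_top _ (lt_top_iff_ne_top.2 hne)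
    have h0 : ∑ i, f (Pi.single i 1) • x i = 0 := by
      refine L.eq_zero_of_form _ fun v => ?_
      have hv : f (T v) = 0 := hf (LinearMap.mem_range_self T v)
      rw [LinearMap.pi_apply_eq_sum_univ f (T v)] at hv
      rw [map_sum, LinearMap.sum_apply, ← hv]
      refine Finset.sum_congr rfl fun i _ => ?_
      have : (fun j => if i = j then (1 : F) else 0) = Pi.single i 1 := by
        ext j; simp [Pi.single_apply, eq_comm]
      rw [this]
      simp [T, mul_comm]
    have h1 := Fintype.linearIndependent_iff.1 hx _ h0
    refine hf0 (LinearMap.pi_ext' fun i => LinearMap.ext_ring ?_)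
    simpa using h1 i
  choose z hz using fun j => LinearMap.range_eq_top.1 hT (Pi.single j 1)
  refine ⟨z, fun i j => ?_⟩
  have := congrFun (hz j) i
  simpa [T, Pi.single_apply] using this

/-- Each z_k is corrected only by the x_i with i < k, which splits the alternating Gram matrix into
a triangular half and avoids division by 2. -/
theorem exists_isotropic_dual_family {n : ℕ} {x : Fin n → V} (hx : LinearIndependent F x)
    (hiso : ∀ i j, L.form (x i) (x j) = 0) :
    ∃ y : Fin n → V, (∀ i j, L.form (x i) (y j) = if i = j then 1 else 0) ∧
      ∀ i j, L.form (y i) (y j) = 0 := by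
  obtain ⟨z, hz⟩ := L.exists_dual_family hx
  have hz' : ∀ i j, L.form (z i) (x j) = if j = i then -1 else 0 := fun i j => by
    rw [L.form_swap, hz]; split_ifs <;> simp
  refine ⟨fun k => z k + ∑ i, (if i < k then L.form (z i) (z k) else 0) • x i,
    fun i j => ?_, fun j k => ?_⟩
  · simp [-ite_smul, hz, hiso]
  · have h1 : L.form (z j) (∑ i, (if i < k then L.form (z i) (z k) else 0) • x i) =
        if j < k then -L.form (z j) (z k) else 0 := by
      simp only [map_sum, map_smul, hz', smul_eq_mul, mul_ite, mul_neg, mul_one, mul_zero,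
        Finset.sum_ite_eq', Finset.mem_univ, if_true]
      split_ifs <;> simp
    have h2 : L.form (∑ i, (if i < j then L.form (z i) (z j) else 0) • x i) (z k) =
        if k < j then L.form (z k) (z j) else 0 := by
      simp [-ite_smul, hz]
    have h3 : L.form (∑ i, (if i < j then L.form (z i) (z j) else 0) • x i)
        (∑ i, (if i < k then L.form (z i) (z k) else 0) • x i) = 0 := by
      simp [-ite_smul, hiso]
    simp only [map_add, LinearMap.add_apply, h1, h2, h3]
    rcases lt_trichotomy j k with h | rfl | h
    · simp [h, h.not_gt]
    · simpa using L.form_isAlt (z j)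
    · simp [h, h.not_gt, L.form_swap (z j) (z k)]

variable {L}

theorem IsFrame.eq_zero {n : ℕ} [NeZero n] {x y : Fin n → V} (h : L.IsFrame x y)
    (hdim : Module.finrank F V = n + n) {v : V} (hx : ∀ i, L.form v (x i) = 0)
    (hy : ∀ i, L.form v (y i) = 0) : v = 0 := by
  obtain ⟨b, hbx, hby⟩ := h.exists_basis hdim
  refine L.eq_zero_of_form v fun w => ?_
  have : L.form v = 0 := b.ext fun i => by
    rcases i with i | i
    · rw [hbx, hx]; rfl
    · rw [hby, hy]; rfl
  rw [this]; rfl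

theorem IsFrame.expand {n : ℕ} [NeZero n] {x y : Fin n → V} (h : L.IsFrame x y)
    (hdim : Module.finrank F V = n + n) (v : V) :
    v = ∑ i, L.form v (y i) • x i + ∑ i, (-L.form v (x i)) • y i := by
  rw [← sub_eq_zero]
  refine h.eq_zero hdim (fun i => ?_) fun i => ?_
  · simp [h.form_xx, h.form_yx]
  · simp [h.form_yy, h.form_xy]

/-- A frame whose leading triple values do not vanish can be rescaled to a normal frame. -/
theorem IsFrame.exists_isNormalFrame {x y : Fin 5 → V} (h : L.IsFrame x y)
    (h345 : L.form (L.mul (x 2) (y 3)) (y 4) ≠ 0) (h235 : L.form (L.mul (x 1) (y 2)) (y 4) ≠ 0)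
    (h125 : L.form (L.mul (x 0) (y 1)) (y 4) ≠ 0) (h134 : L.form (L.mul (x 0) (y 2)) (y 3) ≠ 0)
    (h124 : L.form (L.mul (y 0) (y 1)) (y 3) ≠ 0) (z234 : L.form (L.mul (x 1) (y 2)) (y 3) = 0)
    (z123 : L.form (L.mul (x 0) (y 1)) (y 2) = 0) (z124 : L.form (L.mul (x 0) (y 1)) (y 3) = 0)
    (w123 : L.form (L.mul (y 0) (y 1)) (y 2) = 0) :
    ∃ (x' y' : Fin 5 → V) (r : F), r ≠ 0 ∧ L.IsNormalFrame x' y' r := by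
  set a := L.form (L.mul (x 1) (y 2)) (y 4) with ha
  set b := L.form (L.mul (x 0) (y 1)) (y 4) with hb
  set c := L.form (L.mul (x 0) (y 2)) (y 3) with hc
  set d := L.form (L.mul (y 0) (y 1)) (y 3) with hd
  -- Three of the four equations express s_1, s_2, s_4 through s_3 and s_5; the last becomes s_3²
  -- s_5⁵ = k⁻¹, solved without roots by s_5 = k, s_3 = k⁻³.
  set k := a ^ 3 * b ^ 2 * d / c with hk
  have hk0 : k ≠ 0 := by positivity
  let s : Fin 5 → Fˣ := ![Units.mk0 (k⁻¹ * a * b) (by positivity),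
    Units.mk0 (k⁻¹ ^ 2 * a) (by positivity), Units.mk0 (k⁻¹ ^ 3) (by positivity),
    Units.mk0 (k ^ 2 * a * b / c) (by positivity), Units.mk0 k hk0]
  refine ⟨_, _, _, ?_, ⟨h.scale s, rfl, ?_, ?_, ?_, ?_, ?_, ?_, ?_, ?_⟩⟩
  · simp [h345, s, hk0, h235, h125, h134]
  · simp [s, ← ha]; field_simp
  · simp [s, ← hb]; field_simp
  · simp [s, ← hc]; field_simp
  · simp [s, ← hd]; field_simp; rw [hk]; field_simp
  · simp [z234]
  · simp [z123]
  · simp [z124]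
  · simp [w123]

end Existence

/-! ### The characteristic flag and a standard basis adapted to it -/

section Flag

variable {L : SAA F V}

theorem mul_eq_zero_of_powers {c : ℕ} (hc : L.power (c + 1) = ⊥) {i j : ℕ} (hij : c + 1 ≤ i + j)
    {x y : V} (hx : x ∈ L.power i) (hy : y ∈ L.power j) : L.mul x y = 0 := by
  refine L.eq_zero_of_form _ fun z => ?_
  rw [L.form_mul_swap_right x z y,
    L.form_eq_zero_of_powers hc (by omega) (L.mul_mem_power hx z) hy, neg_zero]

/-- L^5/L^6 and L^2/L^3 are lines and L^6 L^2 = L^5 L^3 = 0, so one product spans L^5 L^2. It is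
nonzero, since otherwise L^5 would be orthogonal to L^3, and central because it is orthogonal to L^3
and to b. -/
theorem exists_mul_eq (h : L.HasMaximalDims) :
    ∃ a ∈ L.power 5, a ∉ L.power 6 ∧ ∃ b ∈ L.power 2, L.mul a b ≠ 0 ∧
      L.mul a b ∈ L.power 7 ∧ L.prod (L.power 5) (L.power 2) = F ∙ L.mul a b := by
  have : FiniteDimensional F V := FiniteDimensional.of_finrank_pos (by have := h.dim; omega)
  obtain ⟨a, ha, ha'⟩ := exists_mem_notMem_of_finrank_lt (A := L.power 6) (B := L.power 5)
    (by rw [h.dim_six, h.dim_five]; omega)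
  obtain ⟨b, hb, hb'⟩ := exists_mem_notMem_of_finrank_lt (A := L.power 3) (B := L.power 2)
    (by rw [h.dim_three, h.dim_two]; omega)
  have h5 := sup_span_singleton_eq (L.power_succ_le 5) (by simp [h.dim_six, h.dim_five]) ha ha'
  have h2 := sup_span_singleton_eq (L.power_succ_le 2) (by simp [h.dim_three, h.dim_two]) hb hb'
  have z1 : ∀ {x y}, x ∈ L.power 5 → y ∈ L.power 3 → L.mul x y = 0 :=
    mul_eq_zero_of_powers h.power_eight (by omega)
  have z2 : ∀ {x y}, x ∈ L.power 6 → y ∈ L.power 2 → L.mul x y = 0 :=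
    mul_eq_zero_of_powers h.power_eight (by omega)
  have hle : L.prod (L.power 5) (L.power 2) ≤ F ∙ L.mul a b := by
    refine L.prod_le.2 fun u hu v hv => ?_
    rw [← h5] at hu
    rw [← h2] at hv
    obtain ⟨l, hl, s, rfl⟩ := mem_sup_span_singleton.1 hu
    obtain ⟨m, hm, t, rfl⟩ := mem_sup_span_singleton.1 hv
    refine Submodule.mem_span_singleton.2 ⟨t * s, ?_⟩
    simp [z1 ha hm, z2 hl hb, z1 (L.power_succ_le 5 hl) hm, smul_smul, mul_comm t s]
  refine ⟨a, ha, ha', b, hb, fun h0 => ?_, ?_,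
    le_antisymm hle ((Submodule.span_singleton_le_iff_mem _ _).2 (L.mul_mem_prod ha hb))⟩
  · refine L.notMem_perp_of_power_ne (k := 4) (m := 2) h.power_seven_ne fun x hx => ?_
    rw [L.mem_perp_power]
    intro z
    rw [L.mem_perp]
    intro l hl
    rw [L.form_mul_swap_right x l z]
    have := hle (L.mul_mem_prod hx hl)
    rw [h0, Submodule.span_zero_singleton, Submodule.mem_bot] at this
    rw [this]; simp
  · rw [← h.perp_power.1, L.mem_perp]
    intro v hv
    rw [← h2] at hv
    obtain ⟨m, hm, t, rfl⟩ := mem_sup_span_singleton.1 hv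
    rw [map_add, map_smul, L.form_mul_self_right, L.form_mul_swap_right a m b, z1 ha hm]
    simp

theorem U_eq (h : L.HasMaximalDims) (hprod : L.prod (L.power 4) (L.power 3) = L.power 7) :
    L.U = L.transporter (L.power 4) (L.power 3) (L.prod (L.power 5) (L.power 2)) := by
  obtain ⟨a, -, -, b, -, hab, hab7, he⟩ := exists_mul_eq h
  have hne : L.prod (L.power 5) (L.power 2) ⊓ L.prod (L.power 4) (L.power 3) ≠ ⊥ := by
    rw [hprod, he]
    intro h0
    have : L.mul a b ∈ (F ∙ L.mul a b) ⊓ L.power 7 :=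
      ⟨Submodule.mem_span_singleton_self _, hab7⟩
    rw [h0, Submodule.mem_bot] at this
    exact hab this
  unfold U firstMeet
  rw [if_pos hne]

/-- There is an element of `U` outside `L⁵`. -/
theorem exists_mem_U (h : L.HasMaximalDims)
    (hprod : L.prod (L.power 4) (L.power 3) = L.power 7) : ∃ u ∈ L.U, u ∉ L.power 5 := by
  have : FiniteDimensional F V := FiniteDimensional.of_finrank_pos (by have := h.dim; omega)
  rw [U_eq h hprod]
  obtain ⟨a, -, -, b, -, hab, hab7, he⟩ := exists_mul_eq h
  set I := L.prod (L.power 5) (L.power 2)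
  have hI : Module.finrank F I = 1 := by rw [he, finrank_span_singleton hab]
  have hI7 : I ≤ L.power 7 := by rw [he]; exact (Submodule.span_singleton_le_iff_mem _ _).2 hab7
  have hpI : L.power 2 ≤ L.perp I := by
    rw [← L.perp_perp (L.power 2), h.perp_power.1]; exact L.perp_anti hI7
  have hpd := L.finrank_perp_add I
  rw [hI, h.dim] at hpd
  obtain ⟨t, ht, ht'⟩ := exists_mem_notMem_of_finrank_lt (A := L.power 2) (B := L.perp I)
    (by rw [h.dim_two]; omega)
  have hpI' := sup_span_singleton_eq hpI (by rw [h.dim_two]; omega) ht ht'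
  obtain ⟨w, hw, hw'⟩ := exists_mem_notMem_of_finrank_lt (A := L.power 4) (B := L.power 3)
    (by rw [h.dim_three, h.dim_four]; omega)
  have h3 := sup_span_singleton_eq (L.power_succ_le 3) (by simp [h.dim_three, h.dim_four]) hw hw'
  -- Since L^4 L^4 = 0, only the product with w matters; since xw lies in L^7, it is in I once it is
  -- orthogonal to t. This is one linear condition, so it has a nonzero solution on the
  -- two-dimensional quotient L^4/L^5.
  have key : ∀ x ∈ L.power 4, L.form (L.mul x w) t = 0 →
      x ∈ L.transporter (L.power 4) (L.power 3) I := by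
    refine fun x hx hxt => ⟨hx, fun y hy => ?_⟩
    rw [← h3] at hy
    obtain ⟨l, hl, s, rfl⟩ := mem_sup_span_singleton.1 hy
    rw [map_add, map_smul, mul_eq_zero_of_powers h.power_eight (by omega) hx hl, zero_add]
    refine I.smul_mem _ ?_
    rw [← L.perp_perp I, L.mem_perp, ← hpI']
    intro v hv
    obtain ⟨m, hm, q, rfl⟩ := mem_sup_span_singleton.1 hv
    have h7 : L.mul x w ∈ L.power 7 := by rw [← hprod]; exact L.mul_mem_prod hx hw
    rw [map_add, map_smul, hxt, L.form_eq_zero_of_powers h.power_eight (by omega) h7 hm]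
    simp
  obtain ⟨u, hu, hu'⟩ := exists_mem_notMem_of_finrank_lt (A := L.power 5) (B := L.power 4)
    (by rw [h.dim_five, h.dim_four]; omega)
  obtain ⟨v, hv, hv'⟩ := exists_mem_notMem_of_finrank_lt (A := L.power 5 ⊔ (F ∙ u))
    (B := L.power 4) (by
      rw [Submodule.finrank_sup_span_singleton hu', h.dim_five, h.dim_four]; omega)
  by_cases hut : L.form (L.mul u w) t = 0
  · exact ⟨u, key u hu hut, hu'⟩
  · set q := L.form (L.mul v w) t / L.form (L.mul u w) t
    refine ⟨v - q • u, key _ (sub_mem hv (Submodule.smul_mem _ _ hu)) ?_, fun hmem => hv' ?_⟩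
    · simp [q, hut]
    · exact mem_sup_span_singleton.2 ⟨_, hmem, q, by abel⟩

/-- A frame that is adapted to the characteristic flag of the algebra. -/
theorem exists_adapted_frame (h : L.HasMaximalDims)
    (hprod : L.prod (L.power 4) (L.power 3) = L.power 7) :
    ∃ x y : Fin 5 → V, (∀ i j, L.form (x i) (x j) = 0) ∧ (∀ i j, L.form (y i) (y j) = 0) ∧
      (∀ i j, L.form (x i) (y j) = if i = j then 1 else 0) ∧
      x 4 ∈ L.prod (L.power 5) (L.power 2) ∧ x 3 ∈ L.power 7 ∧ x 2 ∈ L.power 6 ∧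
      x 1 ∈ L.power 5 ∧ x 0 ∈ L.U ∧ x 2 ∉ L.power 7 ∧ x 1 ∉ L.power 6 ∧ x 0 ∉ L.power 5 ∧
      y 0 ∈ L.power 4 ∧ y 1 ∈ L.power 3 ∧ y 2 ∈ L.power 2 ∧
      y 3 ∈ L.perp (L.prod (L.power 5) (L.power 2)) := by
  have : FiniteDimensional F V := FiniteDimensional.of_finrank_pos (by have := h.dim; omega)
  obtain ⟨a, ha, ha', b, hb, hab, hab7, he⟩ := exists_mul_eq h
  obtain ⟨u, hu, hu'⟩ := exists_mem_U h hprod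
  obtain ⟨p, hp, hp'⟩ := exists_mem_notMem_of_finrank_lt (A := F ∙ L.mul a b) (B := L.power 7)
    (by rw [h.dim_seven, finrank_span_singleton hab]; omega)
  obtain ⟨q, hq, hq'⟩ := exists_mem_notMem_of_finrank_lt (A := L.power 7) (B := L.power 6)
    (by rw [h.dim_seven, h.dim_six]; omega)
  have s7 := sup_span_singleton_eq ((Submodule.span_singleton_le_iff_mem _ _).2 hab7)
    (by rw [h.dim_seven, finrank_span_singleton hab]) hp hp'
  have s6 := sup_span_singleton_eq (L.power_succ_le 6) (by simp [h.dim_six, h.dim_seven]) hq hq'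
  have s5 := sup_span_singleton_eq (L.power_succ_le 5) (by simp [h.dim_six, h.dim_five]) ha ha'
  have hu4 : u ∈ L.power 4 := hu.1
  have iso := L.isotropic_sup_span_singleton (A := L.power 5) (v := u)
    ((L.power_anti (by omega)).trans (L.power_le_perp h.power_eight 4 (by omega)))
    (by rw [← L.perp_perp (L.power 4), h.perp_power.2.2] at hu4; exact hu4)
  have m6 : L.power 6 ≤ L.power 5 := L.power_succ_le 5
  have m7 : L.power 7 ≤ L.power 5 := L.power_anti (by omega)
  have r1 : Submodule.span F (Set.range ![L.mul a b]) = F ∙ L.mul a b := by simp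
  have r2 : Submodule.span F (Set.range ![p, L.mul a b]) = L.power 7 := by
    rw [Matrix.range_cons, Submodule.span_union, r1, sup_comm, s7]
  have r3 : Submodule.span F (Set.range ![q, p, L.mul a b]) = L.power 6 := by
    rw [Matrix.range_cons, Submodule.span_union, r2, sup_comm, s6]
  have r4 : Submodule.span F (Set.range ![a, q, p, L.mul a b]) = L.power 5 := by
    rw [Matrix.range_cons, Submodule.span_union, r3, sup_comm, s5]
  have li : LinearIndependent F ![u, a, q, p, L.mul a b] := by
    refine linearIndependent_finCons.2 ⟨?_, by rwa [r4]⟩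
    refine linearIndependent_finCons.2 ⟨?_, by rwa [r3]⟩
    refine linearIndependent_finCons.2 ⟨?_, by rwa [r2]⟩
    refine linearIndependent_finCons.2 ⟨?_, by rwa [r1]⟩
    exact linearIndependent_unique_iff.2 (by simpa using hab)
  have hmem : ∀ i, (![u, a, q, p, L.mul a b] : Fin 5 → V) i ∈ L.power 5 ⊔ (F ∙ u) := by
    intro i
    fin_cases i
    · exact Submodule.mem_sup_right (Submodule.mem_span_singleton_self u)
    · exact Submodule.mem_sup_left ha
    · exact Submodule.mem_sup_left (m6 hq)
    · exact Submodule.mem_sup_left (m7 hp)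
    · exact Submodule.mem_sup_left (m7 hab7)
  have hiso : ∀ i j, L.form ((![u, a, q, p, L.mul a b] : Fin 5 → V) i)
      ((![u, a, q, p, L.mul a b] : Fin 5 → V) j) = 0 :=
    fun i j => L.mem_perp.1 (iso (hmem i)) _ (hmem j)
  obtain ⟨y, hxy, hyy⟩ := L.exists_isotropic_dual_family li hiso
  have hyx : ∀ i j, L.form (y i) ((![u, a, q, p, L.mul a b] : Fin 5 → V) j) =
      if j = i then -1 else 0 := fun i j => by
    rw [L.form_swap, hxy]; split_ifs <;> simp
  -- an element orthogonal to spanning vectors is orthogonal to the span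
  have hspan : ∀ (S : Set V) (v : V), (∀ s ∈ S, L.form v s = 0) →
      v ∈ L.perp (Submodule.span F S) := by
    intro S v hS
    rw [L.mem_perp]
    intro s hs
    have : Submodule.span F S ≤ LinearMap.ker (L.form v) := Submodule.span_le.2 hS
    exact this hs
  -- For i ≤ 4, y_i is orthogonal to all x_j with j > i, which span L^5, L^6, L^7 and I in turn; the
  -- complements of these are the required members of the flag.
  refine ⟨_, y, hiso, hyy, hxy, ?_, hp, hq, ha, hu, hq', ha', hu', ?_, ?_, ?_, ?_⟩
  · rw [he]; exact Submodule.mem_span_singleton_self _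
  · rw [← L.perp_perp (L.power 4), h.perp_power.2.2, ← r4]
    refine hspan _ _ ?_
    rintro _ ⟨i, rfl⟩
    simpa using hyx 0 i.succ
  · rw [← L.perp_perp (L.power 3), h.perp_power.2.1, ← r3]
    refine hspan _ _ ?_
    rintro _ ⟨i, rfl⟩
    have hne : i.succ.succ ≠ (1 : Fin 5) := by fin_cases i <;> decide
    exact (hyx 1 i.succ.succ).trans (if_neg hne)
  · rw [← L.perp_perp (L.power 2), h.perp_power.1, ← r2]
    refine hspan _ _ ?_
    rintro _ ⟨i, rfl⟩
    have hne : i.succ.succ.succ ≠ (2 : Fin 5) := by fin_cases i <;> decide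
    exact (hyx 2 i.succ.succ.succ).trans (if_neg hne)
  · rw [he]
    refine hspan _ _ ?_
    rintro s rfl
    simpa using hyx 3 4

end Flag

/-! ### The leading values do not vanish; existence of the presentation -/

section Presentation

variable {L : SAA F V}

theorem exists_isNormalFrame (h : L.HasMaximalDims)
    (hprod : L.prod (L.power 4) (L.power 3) = L.power 7)
    (hU : Module.finrank F (L.prod L.U (L.power 2)) = 2) :
    ∃ (x y : Fin 5 → V) (r : F), r ≠ 0 ∧ L.IsNormalFrame x y r := by
  have : FiniteDimensional F V := FiniteDimensional.of_finrank_pos (by have := h.dim; omega)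
  obtain ⟨x, y, hxx, hyy, hxy, x4, x3, x2, x1, x0, x2', x1', x0', y0, y1, y2, y3⟩ :=
    exists_adapted_frame h hprod
  obtain ⟨a, -, -, b, -, hab, hab7, he⟩ := exists_mul_eq h
  have hUeq := U_eq h hprod
  set I := L.prod (L.power 5) (L.power 2)
  have hI1 : Module.finrank F I = 1 := by rw [he, finrank_span_singleton hab]
  have hI7 : I ≤ L.power 7 := by rw [he]; exact (Submodule.span_singleton_le_iff_mem _ _).2 hab7
  have h8 := h.power_eight
  have x0U : x 0 ∈ L.transporter (L.power 4) (L.power 3) I := hUeq ▸ x0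
  have x4' : x 4 ∈ L.power 7 := hI7 x4
  have xmem : ∀ i, x i ∈ L.power 4 := by
    intro i
    fin_cases i
    · exact x0U.1
    · exact L.power_anti (by omega) x1
    · exact L.power_anti (by omega) x2
    · exact L.power_anti (by omega) x3
    · exact L.power_anti (by omega) x4'
  have top : ∀ v : V, v ∈ L.power 1 := fun v => Submodule.mem_top
  have y2z : ∀ i : Fin 5, i ≤ 2 → y i ∈ L.power 2 := by
    intro i hi
    fin_cases i
    · exact L.power_anti (by omega) y0
    · exact L.power_anti (by omega) y1
    · exact y2
    · exact absurd hi (by decide)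
    · exact absurd hi (by decide)
  -- By weights: L^i L^j = 0 as soon as i + j ≥ 8.
  have hf : L.IsFrame x y := by
    refine ⟨hxx, hyy, hxy, fun i j => mul_eq_zero_of_powers h8 (by omega) (xmem i) (xmem j),
      fun i j hji => ?_⟩
    fin_cases i
    · have : j = 0 := by simpa using hji
      subst this
      exact mul_eq_zero_of_powers h8 (by omega) x0U.1 y0
    · refine mul_eq_zero_of_powers (i := 5) (j := 3) h8 (by omega) x1 ?_
      have : j = 0 ∨ j = 1 := by
        revert hji; revert j; decide
      rcases this with rfl | rfl
      · exact L.power_succ_le 3 y0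
      · exact y1
    · exact mul_eq_zero_of_powers (i := 6) (j := 2) h8 (by omega) x2 (y2z j hji)
    · exact mul_eq_zero_of_powers (i := 7) (j := 1) h8 (by omega) x3 (top _)
    · exact mul_eq_zero_of_powers (i := 7) (j := 1) h8 (by omega) x4' (top _)
  have pI : ∀ v ∈ L.power 2, v ∈ L.perp I := by
    rw [← L.perp_perp (L.power 2), h.perp_power.1]
    exact L.perp_anti hI7
  have fI : ∀ {u v}, u ∈ I → v ∈ L.perp I → L.form u v = 0 := fun hu hv => by
    rw [L.form_swap, L.mem_perp.1 hv _ hu, neg_zero]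
  have z234 : L.form (L.mul (x 1) (y 2)) (y 3) = 0 := fI (L.mul_mem_prod x1 y2) y3
  have z123 : L.form (L.mul (x 0) (y 1)) (y 2) = 0 := fI (x0U.2 _ y1) (pI _ y2)
  have z124 : L.form (L.mul (x 0) (y 1)) (y 3) = 0 := fI (x0U.2 _ y1) y3
  have w123 : L.form (L.mul (y 0) (y 1)) (y 2) = 0 :=
    L.form_eq_zero_of_powers h8 (i := 7) (j := 2) (by omega)
      (by rw [← hprod]; exact L.mul_mem_prod y0 y1) y2
  have hdim : Module.finrank F V = 5 + 5 := h.dim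
  -- expansions of the elements of the terms of the flag
  have e9 : ∀ v ∈ L.perp I, ∃ c d : Fin 5 → F, d 4 = 0 ∧
      v = ∑ i, c i • x i + ∑ i, d i • y i := fun v hv =>
    ⟨fun i => L.form v (y i), fun i => -L.form v (x i), by simp [L.mem_perp.1 hv _ x4],
      hf.expand hdim v⟩
  have e8 : ∀ v ∈ L.power 2, ∃ c d : Fin 5 → F, d 3 = 0 ∧ d 4 = 0 ∧
      v = ∑ i, c i • x i + ∑ i, d i • y i := fun v hv =>
    ⟨fun i => L.form v (y i), fun i => -L.form v (x i),
      by simp [L.form_eq_zero_of_powers (i := 2) (j := 7) h8 (by omega) hv x3],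
      by simp [L.form_eq_zero_of_powers (i := 2) (j := 7) h8 (by omega) hv x4'],
      hf.expand hdim v⟩
  have e7 : ∀ v ∈ L.power 3, ∃ c d : Fin 5 → F, d 2 = 0 ∧ d 3 = 0 ∧ d 4 = 0 ∧
      v = ∑ i, c i • x i + ∑ i, d i • y i := fun v hv =>
    ⟨fun i => L.form v (y i), fun i => -L.form v (x i),
      by simp [L.form_eq_zero_of_powers (i := 3) (j := 6) h8 (by omega) hv x2],
      by simp [L.form_eq_zero_of_powers (i := 3) (j := 7) h8 (by omega) hv x3],
      by simp [L.form_eq_zero_of_powers (i := 3) (j := 7) h8 (by omega) hv x4'],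
      hf.expand hdim v⟩
  have e6 : ∀ v ∈ L.power 4, ∃ (c : Fin 5 → F) (d : F), v = ∑ i, c i • x i + d • y 0 := by
    intro v hv
    refine ⟨fun i => L.form v (y i), -L.form v (x 0), (hf.expand hdim v).trans ?_⟩
    rw [Fin.sum_univ_succ (fun i => (-L.form v (x i)) • y i), Fin.sum_univ_four]
    have q1 := L.form_eq_zero_of_powers (i := 4) (j := 5) h8 (by omega) hv x1
    have q2 := L.form_eq_zero_of_powers (i := 4) (j := 6) h8 (by omega) hv x2
    have q3 := L.form_eq_zero_of_powers (i := 4) (j := 7) h8 (by omega) hv x3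
    have q4 := L.form_eq_zero_of_powers (i := 4) (j := 7) h8 (by omega) hv x4'
    have t0 : (0 : Fin 4).succ = (1 : Fin 5) := rfl
    have t1 : (1 : Fin 4).succ = (2 : Fin 5) := rfl
    have t2 : (2 : Fin 4).succ = (3 : Fin 5) := rfl
    have t3 : (3 : Fin 4).succ = (4 : Fin 5) := rfl
    simp only [t0, t1, t2, t3, q1, q2, q3, q4, neg_zero, zero_smul, add_zero]
  -- If it vanished, L^4 L^3 would be orthogonal to I^⊥, hence contained in the line I, while L^7
  -- has dimension 2.
  have h124 : L.form (L.mul (y 0) (y 1)) (y 3) ≠ 0 := by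
    intro h0
    have hle : L.prod (L.power 4) (L.power 3) ≤ I := by
      refine L.prod_le.2 fun u hu v hv => ?_
      rw [← L.perp_perp I, L.mem_perp]
      intro w hw
      obtain ⟨c, d, rfl⟩ := e6 u hu
      obtain ⟨c', d', hd2, hd3, hd4, rfl⟩ := e7 v hv
      obtain ⟨c'', d'', hd4', rfl⟩ := e9 w hw
      simp [Fin.sum_univ_five, hf.rules, h0, z123, z124, w123, hd2, hd3, hd4, hd4']
    have := Submodule.finrank_mono hle
    rw [hprod, h.dim_seven] at this
    omega
  -- The same argument for UL^2; here the hypothesis on its dimension enters.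
  have h134 : L.form (L.mul (x 0) (y 2)) (y 3) ≠ 0 := by
    intro h0
    have hle : L.prod L.U (L.power 2) ≤ I := by
      refine L.prod_le.2 fun u hu v hv => ?_
      rw [← L.perp_perp I, L.mem_perp]
      intro w hw
      rw [hUeq] at hu
      obtain ⟨c, d, rfl⟩ := e6 u hu.1
      -- an element of `U` has no component along `y 0`
      have hd : d = 0 := by
        have := fI (hu.2 _ y1) y3
        simpa [Fin.sum_univ_five, hf.rules, z124, h124] using this
      obtain ⟨c', d', hd3, hd4, rfl⟩ := e8 v hv
      obtain ⟨c'', d'', hd4', rfl⟩ := e9 w hw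
      simp [Fin.sum_univ_five, hf.rules, h0, z123, z124, z234, hd, hd3, hd4, hd4']
    have := Submodule.finrank_mono hle
    omega
  -- Vanishing would make x_1 L orthogonal to L^3 and put x_1 into the third centre L^5. The next
  -- two values keep x_2 out of L^6 and x_3 out of L^7 in the same way.
  have h125 : L.form (L.mul (x 0) (y 1)) (y 4) ≠ 0 := by
    intro h0
    refine x0' ?_
    rw [← h.perp_power.2.2, L.mem_perp_power]
    intro z
    rw [L.mem_perp]
    intro l hl
    obtain ⟨c, d, rfl⟩ : ∃ c d : Fin 5 → F, z = ∑ i, c i • x i + ∑ i, d i • y i :=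
      ⟨fun i => L.form z (y i), fun i => -L.form z (x i), hf.expand hdim z⟩
    obtain ⟨c', d', hd2, hd3, hd4, rfl⟩ := e7 l hl
    simp [Fin.sum_univ_five, hf.rules, h0, z123, z124, hd2, hd3, hd4]
  have h235 : L.form (L.mul (x 1) (y 2)) (y 4) ≠ 0 := by
    intro h0
    refine x1' ?_
    rw [← h.perp_power.2.1, L.mem_perp_power]
    intro z
    rw [L.mem_perp]
    intro l hl
    obtain ⟨c, d, rfl⟩ : ∃ c d : Fin 5 → F, z = ∑ i, c i • x i + ∑ i, d i • y i :=
      ⟨fun i => L.form z (y i), fun i => -L.form z (x i), hf.expand hdim z⟩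
    obtain ⟨c', d', hd3, hd4, rfl⟩ := e8 l hl
    simp [Fin.sum_univ_five, hf.rules, h0, z234, hd3, hd4]
  have h345 : L.form (L.mul (x 2) (y 3)) (y 4) ≠ 0 := by
    intro h0
    refine x2' ?_
    rw [← h.perp_power.1, L.mem_perp_power]
    intro z
    rw [L.mem_perp]
    intro l _
    obtain ⟨c, d, rfl⟩ : ∃ c d : Fin 5 → F, z = ∑ i, c i • x i + ∑ i, d i • y i :=
      ⟨fun i => L.form z (y i), fun i => -L.form z (x i), hf.expand hdim z⟩
    obtain ⟨c', d', rfl⟩ : ∃ c d : Fin 5 → F, l = ∑ i, c i • x i + ∑ i, d i • y i :=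
      ⟨fun i => L.form l (y i), fun i => -L.form l (x i), hf.expand hdim l⟩
    simp [Fin.sum_univ_five, hf.rules, h0]
  exact hf.exists_isNormalFrame h345 h235 h125 h134 h124 z234 z123 z124 w123

theorem IsNormalFrame.hasPresentation {x y : Fin 5 → V} {r : F} (h : L.IsNormalFrame x y r)
    (hdim : Module.finrank F V = 10) : L.HasPresentation 5 (presentation24 r) := by
  obtain ⟨x, y, h, h1, h2, h3, h4, h5, h6, h7, h8, h9, h10, h11⟩ := h.exists_reduced
  obtain ⟨b, hx, hy⟩ := h.exists_basis hdim
  refine ⟨b, ⟨?_, ?_, ?_⟩, ?_, ?_, ?_, ?_⟩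
  · simpa [hx] using h.form_xx
  · simpa [hy] using h.form_yy
  · simpa [hx, hy] using h.form_xy
  · simpa [hx] using h.mul_xx
  · simpa [hx, hy] using h.mul_xy
  · intro i j k hij hjk
    rw [hx, hy, hy]
    fin_cases i <;> fin_cases j <;> first | exact absurd hij (by decide) | skip
    all_goals fin_cases k <;> first | exact absurd hjk (by decide) | skip
    all_goals simp [presentation24, h.values, *]
  · intro i j k hij hjk
    rw [hy, hy, hy]
    fin_cases i <;> fin_cases j <;> first | exact absurd hij (by decide) | skip
    all_goals fin_cases k <;> first | exact absurd hjk (by decide) | skip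
    all_goals simp [presentation24, h.values, *]

theorem IsOfType24.exists_presentation (h : L.IsOfType24) :
    ∃ r : F, r ≠ 0 ∧ L.HasPresentation 5 (presentation24 r) := by
  obtain ⟨h8, h7⟩ := L.nilpotenceClass_spec h.nilpotent h.class_eq
  obtain ⟨x, y, r, hr, hn⟩ :=
    exists_isNormalFrame (L.hasMaximalDims h.dim h8 h7 h.dim_centre) h.prod_eq h.dim_UL2
  exact ⟨r, hr, hn.hasPresentation h.dim⟩

end Presentation

/-! ### A presentation determines the algebra -/

section Uniqueness

variable {L : SAA F V} {M : SAA F W}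

theorem IsPresentedBy.isFrame {n : ℕ} {b : Module.Basis (Fin n ⊕ Fin n) F V}
    {P : NilpotentPresentation F} (h : L.IsPresentedBy b P) :
    L.IsFrame (fun i => b (Sum.inl i)) (fun i => b (Sum.inr i)) :=
  ⟨h.standard.form_x_x, h.standard.form_y_y, h.standard.form_x_y, h.x_mul_x, h.x_mul_y⟩

/-- The triple form is alternating and vanishes when two arguments are x's, so sorting the indices
reduces each value to a listed one or to 0. -/
theorem IsPresentedBy.triple_eq {n : ℕ} {b : Module.Basis (Fin n ⊕ Fin n) F V}
    {b' : Module.Basis (Fin n ⊕ Fin n) F W} {P : NilpotentPresentation F}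
    (h : L.IsPresentedBy b P) (h' : M.IsPresentedBy b' P) (i j k : Fin n ⊕ Fin n) :
    M.form (M.mul (b' i) (b' j)) (b' k) = L.form (L.mul (b i) (b j)) (b k) := by
  have f := h.isFrame
  have f' := h'.isFrame
  have hX : ∀ i j k, M.form (M.mul (b' (Sum.inl i)) (b' (Sum.inr j))) (b' (Sum.inr k)) =
      L.form (L.mul (b (Sum.inl i)) (b (Sum.inr j))) (b (Sum.inr k)) := by
    intro i j k
    rcases le_or_gt j i with hj | hj
    · rw [h.x_mul_y _ _ hj, h'.x_mul_y _ _ hj]; simp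
    rcases le_or_gt k i with hk | hk
    · rw [f.form_xyy_of_le _ _ _ hk, f'.form_xyy_of_le _ _ _ hk]
    rcases lt_trichotomy j k with hjk | rfl | hjk
    · rw [h.triple_xyy _ _ _ hj hjk, h'.triple_xyy _ _ _ hj hjk]
    · rw [L.form_mul_self_right, M.form_mul_self_right]
    · rw [f.form_xyy _ _ _ hjk, f'.form_xyy _ _ _ hjk, h.triple_xyy _ _ _ hk hjk,
        h'.triple_xyy _ _ _ hk hjk]
  have hY₁ : ∀ i j k, i < j → M.form (M.mul (b' (Sum.inr i)) (b' (Sum.inr j))) (b' (Sum.inr k)) =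
      L.form (L.mul (b (Sum.inr i)) (b (Sum.inr j))) (b (Sum.inr k)) := by
    intro i j k hij
    rcases lt_trichotomy j k with hjk | rfl | hjk
    · rw [h.triple_yyy _ _ _ hij hjk, h'.triple_yyy _ _ _ hij hjk]
    · rw [L.form_mul_self_right, M.form_mul_self_right]
    rcases lt_trichotomy i k with hik | rfl | hik
    · rw [f.form_yyy _ _ _ hjk, f'.form_yyy _ _ _ hjk, h.triple_yyy _ _ _ hik hjk,
        h'.triple_yyy _ _ _ hik hjk]
    · rw [L.form_mul_self_outer, M.form_mul_self_outer]
    · rw [← L.form_mul, ← M.form_mul, h.triple_yyy _ _ _ hik hij, h'.triple_yyy _ _ _ hik hij]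
  rcases i with i | i <;> rcases j with j | j
  · rw [h.x_mul_x, h'.x_mul_x]; simp
  · rcases k with k | k
    · rw [f.form_xyx, f'.form_xyx]
    · exact hX i j k
  · rw [L.form_mul_swap_left, M.form_mul_swap_left]
    rcases k with k | k
    · rw [f.form_xyx, f'.form_xyx]
    · rw [hX]
  · rcases k with k | k
    · rw [f.form_yyx, f'.form_yyx, hX]
    · rcases lt_trichotomy i j with hij | rfl | hij
      · exact hY₁ i j k hij
      · rw [L.mul_self, M.mul_self]; simp
      · rw [L.form_mul_swap_left, M.form_mul_swap_left, hY₁ j i k hij]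

/-- Algebras with the same presentation are isomorphic, by an isomorphism that matches the
standard bases. -/
theorem IsPresentedBy.exists_equiv {n : ℕ} {b : Module.Basis (Fin n ⊕ Fin n) F V}
    {b' : Module.Basis (Fin n ⊕ Fin n) F W} {P : NilpotentPresentation F}
    (h : L.IsPresentedBy b P) (h' : M.IsPresentedBy b' P) :
    ∃ e : V ≃ₗ[F] W, (∀ i, e (b i) = b' i) ∧ (∀ x y, M.form (e x) (e y) = L.form x y) ∧
      ∀ x y, e (L.mul x y) = M.mul (e x) (e y) := by
  let e := b.equiv b' (Equiv.refl _)
  have he : ∀ i, e (b i) = b' i := fun i => by simp [e]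
  have hform : ∀ x y, M.form (e x) (e y) = L.form x y := by
    have : M.form.compl₁₂ e.toLinearMap e.toLinearMap = L.form := by
      refine b.ext fun i => b.ext fun j => ?_
      show M.form (e (b i)) (e (b j)) = _
      rw [he, he]
      rcases i with i | i <;> rcases j with j | j
      · rw [h.standard.form_x_x, h'.standard.form_x_x]
      · rw [h.standard.form_x_y, h'.standard.form_x_y]
      · rw [L.form_swap, M.form_swap, h.standard.form_x_y, h'.standard.form_x_y]
      · rw [h.standard.form_y_y, h'.standard.form_y_y]
    intro x y
    exact LinearMap.congr_fun (LinearMap.congr_fun this x) y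
  have htri : ∀ x y z, M.form (M.mul (e x) (e y)) (e z) = L.form (L.mul x y) z := by
    have : (M.mul.compl₁₂ e.toLinearMap e.toLinearMap).compr₂ (M.form.compl₂ e.toLinearMap) =
        L.mul.compr₂ L.form := by
      refine b.ext fun i => b.ext fun j => b.ext fun k => ?_
      show M.form (M.mul (e (b i)) (e (b j))) (e (b k)) = _
      rw [he, he, he]
      exact h.triple_eq h' i j k
    intro x y z
    exact LinearMap.congr_fun (LinearMap.congr_fun (LinearMap.congr_fun this x) y) z
  refine ⟨e, he, hform, fun x y => ?_⟩
  -- The form is nondegenerate, so a product is determined by its triple values.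
  rw [← sub_eq_zero]
  refine M.eq_zero_of_form _ fun w => ?_
  obtain ⟨z, rfl⟩ := e.surjective w
  rw [map_sub, LinearMap.sub_apply, hform, htri, sub_self]

theorem HasPresentation.isomorphic {n : ℕ} {P : NilpotentPresentation F}
    (h : L.HasPresentation n P) (h' : M.HasPresentation n P) : L.Isomorphic M := by
  obtain ⟨b, hb⟩ := h
  obtain ⟨b', hb'⟩ := h'
  obtain ⟨e, -, h1, h2⟩ := hb.exists_equiv hb'
  exact ⟨e, h1, h2⟩

theorem HasPresentation.of_isomorphic {n : ℕ} {P : NilpotentPresentation F}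
    (h : M.HasPresentation n P) (hLM : L.Isomorphic M) : L.HasPresentation n P := by
  obtain ⟨b, hb⟩ := h
  obtain ⟨e, hf, hm⟩ := hLM
  have hf' : ∀ x y, L.form (e.symm x) (e.symm y) = M.form x y := fun x y => by
    rw [← hf]; simp
  have hm' : ∀ x y, L.mul (e.symm x) (e.symm y) = e.symm (M.mul x y) := fun x y => by
    rw [LinearEquiv.eq_symm_apply, hm]; simp
  refine ⟨b.map e.symm, ⟨?_, ?_, ?_⟩, ?_, ?_, ?_, ?_⟩
  · simpa [hf'] using hb.standard.form_x_x
  · simpa [hf'] using hb.standard.form_y_y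
  · simpa [hf'] using hb.standard.form_x_y
  · simpa [hm'] using hb.x_mul_x
  · simpa [hm'] using hb.x_mul_y
  · simpa [hf', hm'] using hb.triple_xyy
  · simpa [hf', hm'] using hb.triple_yyy

end Uniqueness

/-! ### An explicit algebra for every parameter -/

section Model

/-- The `2 × 2` minor of two vectors at two coordinates. -/
def minor {ι : Type*} (u v : ι → F) (p q : ι) : F := u p * v q - u q * v p

/-- The product of the model algebra with parameter `r`, in coordinates. -/
def modelMul (r : F) (u v : Fin 5 ⊕ Fin 5 → F) : Fin 5 ⊕ Fin 5 → F :=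
  -- The x_i-coordinate of uv is (uv, y_i) and its y_i-coordinate is -(uv, x_i), where the triple
  -- form is a sum of five 3 × 3 determinants, one for each displayed value, expanded along the
  -- third argument.
  Sum.elim
    ![minor u v (.inr 1) (.inr 3),
      minor u v (.inr 4) (.inl 0) + minor u v (.inr 3) (.inr 0),
      minor u v (.inr 4) (.inl 1) + minor u v (.inr 3) (.inl 0),
      r * minor u v (.inr 4) (.inl 2) + minor u v (.inl 0) (.inr 2) + minor u v (.inr 0) (.inr 1),
      r * minor u v (.inl 2) (.inr 3) + minor u v (.inl 1) (.inr 2) + minor u v (.inl 0) (.inr 1)]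
    ![-(minor u v (.inr 1) (.inr 4) + minor u v (.inr 2) (.inr 3)),
      -minor u v (.inr 2) (.inr 4),
      -(r * minor u v (.inr 3) (.inr 4)), 0, 0]

/-- The standard symplectic form in coordinates. -/
def modelForm (u v : Fin 5 ⊕ Fin 5 → F) : F :=
  ∑ i, (u (.inl i) * v (.inr i) - u (.inr i) * v (.inl i))

set_option maxHeartbeats 1000000 in
/-- The symplectic alternating algebra with the presentation `presentation24 r`. -/
def model (r : F) : SAA F (Fin 5 ⊕ Fin 5 → F) where
  form := LinearMap.mk₂ F modelForm
    (fun u u' v => by simp only [modelForm, Fin.sum_univ_five, Pi.add_apply]; ring)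
    (fun c u v => by
      simp only [modelForm, Fin.sum_univ_five, Pi.smul_apply, smul_eq_mul]; ring)
    (fun u v v' => by simp only [modelForm, Fin.sum_univ_five, Pi.add_apply]; ring)
    (fun c u v => by
      simp only [modelForm, Fin.sum_univ_five, Pi.smul_apply, smul_eq_mul]; ring)
  form_isAlt := fun u => by
    simp only [LinearMap.mk₂_apply, modelForm, mul_comm, sub_self, Finset.sum_const_zero]
  form_nondegenerate := by
    have h : ∀ u : Fin 5 ⊕ Fin 5 → F, (∀ v, modelForm u v = 0) → u = 0 := by
      intro u hu
      funext i
      rcases i with i | i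
      · simpa [modelForm, Pi.single_apply] using hu (Pi.single (.inr i) 1)
      · simpa [modelForm, Pi.single_apply] using hu (Pi.single (.inl i) 1)
    refine ⟨fun u hu => h u fun v => hu v, fun u hu => h u fun v => ?_⟩
    have := hu v
    rw [LinearMap.mk₂_apply] at this
    rw [← neg_eq_zero, ← this]
    simp only [modelForm, Fin.sum_univ_five]; ring
  mul := LinearMap.mk₂ F (modelMul r)
    (fun u u' v => by
      ext i
      rcases i with i | i <;> fin_cases i <;> simp [modelMul, minor] <;> ring)
    (fun c u v => by
      ext i
      rcases i with i | i <;> fin_cases i <;> simp [modelMul, minor] <;> ring)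
    (fun u v v' => by
      ext i
      rcases i with i | i <;> fin_cases i <;> simp [modelMul, minor] <;> ring)
    (fun c u v => by
      ext i
      rcases i with i | i <;> fin_cases i <;> simp [modelMul, minor] <;> ring)
  mul_self := fun u => by
    ext i
    rcases i with i | i <;> fin_cases i <;> simp [modelMul, minor, mul_comm]
  form_mul := fun u v w => by
    simp [modelForm, Fin.sum_univ_five, modelMul, minor]; ring

theorem model_form (r : F) (u v : Fin 5 ⊕ Fin 5 → F) : (model r).form u v = modelForm u v := rfl

theorem model_mul (r : F) (u v : Fin 5 ⊕ Fin 5 → F) : (model r).mul u v = modelMul r u v := rfl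

set_option maxHeartbeats 4000000 in
theorem model_isPresentedBy (r : F) :
    (model r).IsPresentedBy (Pi.basisFun F (Fin 5 ⊕ Fin 5)) (presentation24 r) := by
  refine ⟨⟨fun i j => ?_, fun i j => ?_, fun i j => ?_⟩, fun i j => ?_, fun i j hji => ?_,
    fun i j k hij hjk => ?_, fun i j k hij hjk => ?_⟩
  · simp [model_form, modelForm]
  · simp [model_form, modelForm]
  · simp [model_form, modelForm, Pi.single_apply, eq_comm]
  · rw [model_mul]
    ext k
    rcases k with k | k <;> fin_cases k <;> simp [modelMul, minor]
  · rw [model_mul]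
    ext k
    fin_cases i <;> fin_cases j <;> first | exact absurd hji (by decide) | skip
    all_goals rcases k with k | k <;> fin_cases k <;> simp [modelMul, minor]
  · fin_cases i <;> fin_cases j <;> first | exact absurd hij (by decide) | skip
    all_goals fin_cases k <;> first | exact absurd hjk (by decide) | skip
    all_goals simp [presentation24, model_form, model_mul, modelForm, Fin.sum_univ_five, modelMul,
      minor]
  · fin_cases i <;> fin_cases j <;> first | exact absurd hij (by decide) | skip
    all_goals fin_cases k <;> first | exact absurd hjk (by decide) | skip
    all_goals simp [presentation24, model_form, model_mul, modelForm, Fin.sum_univ_five, modelMul,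
      minor]

theorem model_hasPresentation (r : F) : (model r).HasPresentation 5 (presentation24 r) :=
  ⟨_, model_isPresentedBy r⟩

end Model

/-! ### Coordinate subspaces and products of basis vectors -/

section Coordinates

/-- Coordinates on `L` in which the form and the product are those of the model algebra. -/
structure IsChart (L : SAA F V) (r : F) (e : V ≃ₗ[F] (Fin 5 ⊕ Fin 5 → F)) : Prop where
  form_eq : ∀ u v, L.form u v = modelForm (e u) (e v)
  mul_eq : ∀ u v, e (L.mul u v) = modelMul r (e u) (e v)

theorem HasPresentation.exists_chart {L : SAA F V} {r : F}
    (h : L.HasPresentation 5 (presentation24 r)) : ∃ e, L.IsChart r e := by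
  obtain ⟨e, h1, h2⟩ := h.isomorphic (model_hasPresentation r)
  exact ⟨e, fun u v => (h1 u v).symm, h2⟩

/-- The subspace on which the coordinates in `s` vanish. -/
def vanish {ι : Type*} (e : V ≃ₗ[F] (ι → F)) (s : Finset ι) : Submodule F V where
  carrier := {v | ∀ i ∈ s, e v i = 0}
  zero_mem' := by simp
  add_mem' := fun hu hv i hi => by simp [hu i hi, hv i hi]
  smul_mem' := fun c u hu i hi => by simp [hu i hi]

theorem mem_vanish {ι : Type*} {e : V ≃ₗ[F] (ι → F)} {s : Finset ι} {v : V} :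
    v ∈ vanish e s ↔ ∀ i ∈ s, e v i = 0 := Iff.rfl

theorem vanish_le {ι : Type*} [Fintype ι] [DecidableEq ι] {e : V ≃ₗ[F] (ι → F)} {s : Finset ι}
    {A : Submodule F V} (h : ∀ i ∉ s, e.symm (Pi.single i 1) ∈ A) : vanish e s ≤ A := by
  intro v hv
  have : v = ∑ i, e v i • e.symm (Pi.single i 1) := by
    apply e.injective
    rw [map_sum]
    ext j
    simp [Finset.sum_apply, Pi.single_apply]
  rw [this]
  refine A.sum_mem fun i _ => ?_
  by_cases hi : i ∈ s
  · rw [mem_vanish.1 hv i hi, zero_smul]; exact A.zero_mem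
  · exact A.smul_mem _ (h i hi)

theorem finrank_vanish {ι : Type*} [Fintype ι] [DecidableEq ι] (e : V ≃ₗ[F] (ι → F))
    (s : Finset ι) : Module.finrank F (vanish e s) = sᶜ.card := by
  have h : vanish e s = Submodule.span F
      (Set.range fun i : {i // i ∈ sᶜ} => e.symm (Pi.single i.1 1)) := by
    refine le_antisymm (vanish_le fun i hi => Submodule.subset_span ⟨⟨i, by simpa using hi⟩, rfl⟩)
      (Submodule.span_le.2 ?_)
    rintro _ ⟨⟨i, hi⟩, rfl⟩ j hj
    have : j ≠ i := fun hji => by subst hji; simp [hj] at hi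
    simp [this]
  have li : LinearIndependent F fun i : ι => e.symm (Pi.single i (1 : F)) := by
    simpa [Function.comp_def] using
      (Pi.basisFun F ι).linearIndependent.map' e.symm.toLinearMap e.symm.ker
  rw [h]
  refine (finrank_span_eq_card (li.comp (fun i : {i // i ∈ sᶜ} => i.1)
    Subtype.val_injective)).trans ?_
  rw [Fintype.card_coe]

namespace IsChart

variable {L : SAA F V} {r : F} {e : V ≃ₗ[F] (Fin 5 ⊕ Fin 5 → F)}

theorem mul_single (h : L.IsChart r e) (i j : Fin 5 ⊕ Fin 5) :
    L.mul (e.symm (Pi.single i 1)) (e.symm (Pi.single j 1)) =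
      e.symm (modelMul r (Pi.single i 1) (Pi.single j 1)) := by
  apply e.injective
  simp [h.mul_eq]

/-- The source of all lower bounds for the powers: where a product of two basis vectors is a nonzero
multiple of a third, that third vector lies in the product space. -/
theorem single_mem_prod (h : L.IsChart r e) {A B : Submodule F V} (i j : Fin 5 ⊕ Fin 5)
    (c : F) (hc : c ≠ 0) {k : Fin 5 ⊕ Fin 5}
    (hi : e.symm (Pi.single i 1) ∈ A) (hj : e.symm (Pi.single j 1) ∈ B)
    (hk : ∀ l, modelMul r (Pi.single i 1) (Pi.single j 1) l = (Pi.single k c : _ → F) l) :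
    e.symm (Pi.single k 1) ∈ L.prod A B := by
  have h1 := L.mul_mem_prod hi hj
  rw [h.mul_single, funext hk] at h1
  have h2 : (Pi.single k 1 : Fin 5 ⊕ Fin 5 → F) = c⁻¹ • Pi.single k c := by
    ext l; simp [Pi.single_apply, hc]
  rw [h2, map_smul]
  exact Submodule.smul_mem _ _ h1

theorem x1_mem_prod_y2_y4 (h : L.IsChart r e) {A B : Submodule F V}
    (hA : e.symm (Pi.single (Sum.inr 1) 1) ∈ A) (hB : e.symm (Pi.single (Sum.inr 3) 1) ∈ B) :
    e.symm (Pi.single (Sum.inl 0) 1) ∈ L.prod A B :=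
  h.single_mem_prod _ _ 1 (by simp) hA hB fun l => by
    rcases l with l | l <;> fin_cases l <;> simp [modelMul, minor]

theorem x2_mem_prod_y1_y4 (h : L.IsChart r e) {A B : Submodule F V}
    (hA : e.symm (Pi.single (Sum.inr 0) 1) ∈ A) (hB : e.symm (Pi.single (Sum.inr 3) 1) ∈ B) :
    e.symm (Pi.single (Sum.inl 1) 1) ∈ L.prod A B :=
  h.single_mem_prod _ _ (-1) (by simp) hA hB fun l => by
    rcases l with l | l <;> fin_cases l <;> simp [modelMul, minor]

theorem x3_mem_prod_x2_y5 (h : L.IsChart r e) {A B : Submodule F V}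
    (hA : e.symm (Pi.single (Sum.inl 1) 1) ∈ A) (hB : e.symm (Pi.single (Sum.inr 4) 1) ∈ B) :
    e.symm (Pi.single (Sum.inl 2) 1) ∈ L.prod A B :=
  h.single_mem_prod _ _ (-1) (by simp) hA hB fun l => by
    rcases l with l | l <;> fin_cases l <;> simp [modelMul, minor]

theorem x4_mem_prod_x3_y5 (h : L.IsChart r e) (hr : r ≠ 0) {A B : Submodule F V}
    (hA : e.symm (Pi.single (Sum.inl 2) 1) ∈ A) (hB : e.symm (Pi.single (Sum.inr 4) 1) ∈ B) :
    e.symm (Pi.single (Sum.inl 3) 1) ∈ L.prod A B :=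
  h.single_mem_prod _ _ (-r) (by simp [hr]) hA hB fun l => by
    rcases l with l | l <;> fin_cases l <;> simp [modelMul, minor]

theorem x5_mem_prod_x3_y4 (h : L.IsChart r e) (hr : r ≠ 0) {A B : Submodule F V}
    (hA : e.symm (Pi.single (Sum.inl 2) 1) ∈ A) (hB : e.symm (Pi.single (Sum.inr 3) 1) ∈ B) :
    e.symm (Pi.single (Sum.inl 4) 1) ∈ L.prod A B :=
  h.single_mem_prod _ _ r (by simp [hr]) hA hB fun l => by
    rcases l with l | l <;> fin_cases l <;> simp [modelMul, minor]

theorem y1_mem_prod_y2_y5 (h : L.IsChart r e) {A B : Submodule F V}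
    (hA : e.symm (Pi.single (Sum.inr 1) 1) ∈ A) (hB : e.symm (Pi.single (Sum.inr 4) 1) ∈ B) :
    e.symm (Pi.single (Sum.inr 0) 1) ∈ L.prod A B :=
  h.single_mem_prod _ _ (-1) (by simp) hA hB fun l => by
    rcases l with l | l <;> fin_cases l <;> simp [modelMul, minor]

theorem y2_mem_prod_y3_y5 (h : L.IsChart r e) {A B : Submodule F V}
    (hA : e.symm (Pi.single (Sum.inr 2) 1) ∈ A) (hB : e.symm (Pi.single (Sum.inr 4) 1) ∈ B) :
    e.symm (Pi.single (Sum.inr 1) 1) ∈ L.prod A B :=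
  h.single_mem_prod _ _ (-1) (by simp) hA hB fun l => by
    rcases l with l | l <;> fin_cases l <;> simp [modelMul, minor]

theorem y3_mem_prod_y4_y5 (h : L.IsChart r e) (hr : r ≠ 0) {A B : Submodule F V}
    (hA : e.symm (Pi.single (Sum.inr 3) 1) ∈ A) (hB : e.symm (Pi.single (Sum.inr 4) 1) ∈ B) :
    e.symm (Pi.single (Sum.inr 2) 1) ∈ L.prod A B :=
  h.single_mem_prod _ _ (-r) (by simp [hr]) hA hB fun l => by
    rcases l with l | l <;> fin_cases l <;> simp [modelMul, minor]

theorem x5_mem_prod_x2_y3 (h : L.IsChart r e) {A B : Submodule F V}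
    (hA : e.symm (Pi.single (Sum.inl 1) 1) ∈ A) (hB : e.symm (Pi.single (Sum.inr 2) 1) ∈ B) :
    e.symm (Pi.single (Sum.inl 4) 1) ∈ L.prod A B :=
  h.single_mem_prod _ _ 1 (by simp) hA hB fun l => by
    rcases l with l | l <;> fin_cases l <;> simp [modelMul, minor]

theorem x5_mem_prod_x1_y2 (h : L.IsChart r e) {A B : Submodule F V}
    (hA : e.symm (Pi.single (Sum.inl 0) 1) ∈ A) (hB : e.symm (Pi.single (Sum.inr 1) 1) ∈ B) :
    e.symm (Pi.single (Sum.inl 4) 1) ∈ L.prod A B :=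
  h.single_mem_prod _ _ 1 (by simp) hA hB fun l => by
    rcases l with l | l <;> fin_cases l <;> simp [modelMul, minor]

theorem x4_mem_prod_y1_y2 (h : L.IsChart r e) {A B : Submodule F V}
    (hA : e.symm (Pi.single (Sum.inr 0) 1) ∈ A) (hB : e.symm (Pi.single (Sum.inr 1) 1) ∈ B) :
    e.symm (Pi.single (Sum.inl 3) 1) ∈ L.prod A B :=
  h.single_mem_prod _ _ 1 (by simp) hA hB fun l => by
    rcases l with l | l <;> fin_cases l <;> simp [modelMul, minor]

theorem x4_mem_prod_x1_y3 (h : L.IsChart r e) {A B : Submodule F V}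
    (hA : e.symm (Pi.single (Sum.inl 0) 1) ∈ A) (hB : e.symm (Pi.single (Sum.inr 2) 1) ∈ B) :
    e.symm (Pi.single (Sum.inl 3) 1) ∈ L.prod A B :=
  h.single_mem_prod _ _ 1 (by simp) hA hB fun l => by
    rcases l with l | l <;> fin_cases l <;> simp [modelMul, minor]

end IsChart
end Coordinates

/-! ### The flag of the model and the listed properties -/

section Powers

namespace IsChart

variable {L : SAA F V} {r : F} {e : V ≃ₗ[F] (Fin 5 ⊕ Fin 5 → F)}

theorem single_mem_vanish {i : Fin 5 ⊕ Fin 5} {s : Finset (Fin 5 ⊕ Fin 5)} (hi : i ∉ s) :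
    e.symm (Pi.single i 1) ∈ vanish e s := by
  intro j hj
  have : j ≠ i := fun hji => hi (hji ▸ hj)
  simp [this]

/-- One inclusion is read off from the coordinates of a product, the other exhibits each remaining
basis vector as a multiple of a product. The later powers and the mixed products follow the same
scheme. -/
theorem power_two (h : L.IsChart r e) (hr : r ≠ 0) : L.power 2 =
    vanish e {.inr 3, .inr 4} := by
  show L.prod (L.power 1) ⊤ = _
  show L.prod ⊤ ⊤ = _
  refine le_antisymm (L.prod_le.2 fun u hu v hv => ?_) (vanish_le fun i hi => ?_)
  · simp only [mem_vanish, Finset.forall_mem_insert, Finset.mem_singleton, forall_eq, h.mul_eq]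
    simp [modelMul, minor]
  · rcases i with i | i <;> fin_cases i <;> first | exact absurd hi (by decide) | skip
    · exact h.x1_mem_prod_y2_y4 Submodule.mem_top Submodule.mem_top
    · exact h.x2_mem_prod_y1_y4 Submodule.mem_top Submodule.mem_top
    · exact h.x3_mem_prod_x2_y5 Submodule.mem_top Submodule.mem_top
    · exact h.x4_mem_prod_x3_y5 hr Submodule.mem_top Submodule.mem_top
    · exact h.x5_mem_prod_x3_y4 hr Submodule.mem_top Submodule.mem_top
    · exact h.y1_mem_prod_y2_y5 Submodule.mem_top Submodule.mem_top
    · exact h.y2_mem_prod_y3_y5 Submodule.mem_top Submodule.mem_top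
    · exact h.y3_mem_prod_y4_y5 hr Submodule.mem_top Submodule.mem_top

theorem power_three (h : L.IsChart r e) (hr : r ≠ 0) : L.power 3 =
    vanish e {.inr 2, .inr 3, .inr 4} := by
  show L.prod (L.power 2) ⊤ = _
  rw [h.power_two hr]
  refine le_antisymm (L.prod_le.2 fun u hu v hv => ?_) (vanish_le fun i hi => ?_)
  · simp only [mem_vanish, Finset.forall_mem_insert, Finset.mem_singleton, forall_eq, h.mul_eq]
      at hu ⊢
    simp [modelMul, minor, hu]
  · rcases i with i | i <;> fin_cases i <;> first | exact absurd hi (by decide) | skip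
    · exact h.x1_mem_prod_y2_y4 (single_mem_vanish (by decide)) Submodule.mem_top
    · exact h.x2_mem_prod_y1_y4 (single_mem_vanish (by decide)) Submodule.mem_top
    · exact h.x3_mem_prod_x2_y5 (single_mem_vanish (by decide)) Submodule.mem_top
    · exact h.x4_mem_prod_x3_y5 hr (single_mem_vanish (by decide)) Submodule.mem_top
    · exact h.x5_mem_prod_x3_y4 hr (single_mem_vanish (by decide)) Submodule.mem_top
    · exact h.y1_mem_prod_y2_y5 (single_mem_vanish (by decide)) Submodule.mem_top
    · exact h.y2_mem_prod_y3_y5 (single_mem_vanish (by decide)) Submodule.mem_top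

theorem power_four (h : L.IsChart r e) (hr : r ≠ 0) : L.power 4 =
    vanish e {.inr 1, .inr 2, .inr 3, .inr 4} := by
  show L.prod (L.power 3) ⊤ = _
  rw [h.power_three hr]
  refine le_antisymm (L.prod_le.2 fun u hu v hv => ?_) (vanish_le fun i hi => ?_)
  · simp only [mem_vanish, Finset.forall_mem_insert, Finset.mem_singleton, forall_eq, h.mul_eq]
      at hu ⊢
    simp [modelMul, minor, hu]
  · rcases i with i | i <;> fin_cases i <;> first | exact absurd hi (by decide) | skip
    · exact h.x1_mem_prod_y2_y4 (single_mem_vanish (by decide)) Submodule.mem_top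
    · exact h.x2_mem_prod_y1_y4 (single_mem_vanish (by decide)) Submodule.mem_top
    · exact h.x3_mem_prod_x2_y5 (single_mem_vanish (by decide)) Submodule.mem_top
    · exact h.x4_mem_prod_x3_y5 hr (single_mem_vanish (by decide)) Submodule.mem_top
    · exact h.x5_mem_prod_x3_y4 hr (single_mem_vanish (by decide)) Submodule.mem_top
    · exact h.y1_mem_prod_y2_y5 (single_mem_vanish (by decide)) Submodule.mem_top

theorem power_five (h : L.IsChart r e) (hr : r ≠ 0) : L.power 5 =
    vanish e {.inl 0, .inr 0, .inr 1, .inr 2, .inr 3, .inr 4} := by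
  show L.prod (L.power 4) ⊤ = _
  rw [h.power_four hr]
  refine le_antisymm (L.prod_le.2 fun u hu v hv => ?_) (vanish_le fun i hi => ?_)
  · simp only [mem_vanish, Finset.forall_mem_insert, Finset.mem_singleton, forall_eq, h.mul_eq]
      at hu ⊢
    simp [modelMul, minor, hu]
  · rcases i with i | i <;> fin_cases i <;> first | exact absurd hi (by decide) | skip
    · exact h.x2_mem_prod_y1_y4 (single_mem_vanish (by decide)) Submodule.mem_top
    · exact h.x3_mem_prod_x2_y5 (single_mem_vanish (by decide)) Submodule.mem_top
    · exact h.x4_mem_prod_x3_y5 hr (single_mem_vanish (by decide)) Submodule.mem_top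
    · exact h.x5_mem_prod_x3_y4 hr (single_mem_vanish (by decide)) Submodule.mem_top

theorem power_six (h : L.IsChart r e) (hr : r ≠ 0) : L.power 6 =
    vanish e {.inl 1, .inl 0, .inr 0, .inr 1, .inr 2, .inr 3, .inr 4} := by
  show L.prod (L.power 5) ⊤ = _
  rw [h.power_five hr]
  refine le_antisymm (L.prod_le.2 fun u hu v hv => ?_) (vanish_le fun i hi => ?_)
  · simp only [mem_vanish, Finset.forall_mem_insert, Finset.mem_singleton, forall_eq, h.mul_eq]
      at hu ⊢
    simp [modelMul, minor, hu]
  · rcases i with i | i <;> fin_cases i <;> first | exact absurd hi (by decide) | skip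
    · exact h.x3_mem_prod_x2_y5 (single_mem_vanish (by decide)) Submodule.mem_top
    · exact h.x4_mem_prod_x3_y5 hr (single_mem_vanish (by decide)) Submodule.mem_top
    · exact h.x5_mem_prod_x3_y4 hr (single_mem_vanish (by decide)) Submodule.mem_top

theorem power_seven (h : L.IsChart r e) (hr : r ≠ 0) : L.power 7 =
    vanish e {.inl 2, .inl 1, .inl 0, .inr 0, .inr 1, .inr 2, .inr 3, .inr 4} := by
  show L.prod (L.power 6) ⊤ = _
  rw [h.power_six hr]
  refine le_antisymm (L.prod_le.2 fun u hu v hv => ?_) (vanish_le fun i hi => ?_)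
  · simp only [mem_vanish, Finset.forall_mem_insert, Finset.mem_singleton, forall_eq, h.mul_eq]
      at hu ⊢
    simp [modelMul, minor, hu]
  · rcases i with i | i <;> fin_cases i <;> first | exact absurd hi (by decide) | skip
    · exact h.x4_mem_prod_x3_y5 hr (single_mem_vanish (by decide)) Submodule.mem_top
    · exact h.x5_mem_prod_x3_y4 hr (single_mem_vanish (by decide)) Submodule.mem_top

theorem power_eight (h : L.IsChart r e) (hr : r ≠ 0) : L.power 8 = ⊥ := by
  show L.prod (L.power 7) ⊤ = _
  rw [h.power_seven hr, eq_bot_iff]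
  refine L.prod_le.2 fun u hu v _ => (Submodule.mem_bot F).2 (e.injective ?_)
  simp only [mem_vanish, Finset.forall_mem_insert, Finset.mem_singleton, forall_eq] at hu
  rw [h.mul_eq, map_zero]
  ext i
  rcases i with i | i <;> fin_cases i <;> simp [modelMul, minor, hu]

theorem prod_five_two (h : L.IsChart r e) (hr : r ≠ 0) : L.prod (L.power 5) (L.power 2) =
    vanish e {.inl 3, .inl 2, .inl 1, .inl 0, .inr 0, .inr 1, .inr 2, .inr 3, .inr 4} := by
  rw [h.power_five hr, h.power_two hr]
  refine le_antisymm (L.prod_le.2 fun u hu v hv => ?_) (vanish_le fun i hi => ?_)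
  · simp only [mem_vanish, Finset.forall_mem_insert, Finset.mem_singleton, forall_eq, h.mul_eq]
      at hu hv ⊢
    simp [modelMul, minor, hu, hv]
  · rcases i with i | i <;> fin_cases i <;> first | exact absurd hi (by decide) | skip
    · exact h.x5_mem_prod_x2_y3 (single_mem_vanish (by decide)) (single_mem_vanish (by decide))

theorem prod_four_three (h : L.IsChart r e) (hr : r ≠ 0) : L.prod (L.power 4) (L.power 3) =
    vanish e {.inl 2, .inl 1, .inl 0, .inr 0, .inr 1, .inr 2, .inr 3, .inr 4} := by
  rw [h.power_four hr, h.power_three hr]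
  refine le_antisymm (L.prod_le.2 fun u hu v hv => ?_) (vanish_le fun i hi => ?_)
  · simp only [mem_vanish, Finset.forall_mem_insert, Finset.mem_singleton, forall_eq, h.mul_eq]
      at hu hv ⊢
    simp [modelMul, minor, hu, hv]
  · rcases i with i | i <;> fin_cases i <;> first | exact absurd hi (by decide) | skip
    · exact h.x4_mem_prod_y1_y2 (single_mem_vanish (by decide)) (single_mem_vanish (by decide))
    · exact h.x5_mem_prod_x1_y2 (single_mem_vanish (by decide)) (single_mem_vanish (by decide))

theorem hasMaximalDims (h : L.IsChart r e) (hr : r ≠ 0) : L.HasMaximalDims := by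
  refine ⟨h.power_eight hr, fun h7 => ?_, ?_, ?_, ?_, ?_, ?_, ?_, ?_⟩
  · have := finrank_vanish e {.inl 2, .inl 1, .inl 0, .inr 0, .inr 1, .inr 2, .inr 3, .inr 4}
    rw [← h.power_seven hr, h7, finrank_bot] at this
    exact absurd this (by decide)
  · rw [e.finrank_eq]; simp
  · rw [h.power_two hr, finrank_vanish]; decide
  · rw [h.power_three hr, finrank_vanish]; decide
  · rw [h.power_four hr, finrank_vanish]; decide
  · rw [h.power_five hr, finrank_vanish]; decide
  · rw [h.power_six hr, finrank_vanish]; decide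
  · rw [h.power_seven hr, finrank_vanish]; decide

theorem U_eq_vanish (h : L.IsChart r e) (hr : r ≠ 0) : L.U =
    vanish e {.inr 0, .inr 1, .inr 2, .inr 3, .inr 4} := by
  rw [U_eq (h.hasMaximalDims hr) (by rw [h.prod_four_three hr, h.power_seven hr]),
    h.power_four hr, h.power_three hr, h.prod_five_two hr]
  refine le_antisymm (fun u hu => ?_) fun u hu => ⟨?_, fun v hv => ?_⟩
  · have h1 := hu.1
    -- Testing against y_2 suffices: for u in L^4 the x_4-coordinate of u y_2 is the y_1-coordinate
    -- of u.
    have h2 := hu.2 (e.symm (Pi.single (.inr 1) 1)) (single_mem_vanish (by decide))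
    simp only [mem_vanish, Finset.forall_mem_insert, Finset.mem_singleton, forall_eq, h.mul_eq]
      at h1 h2 ⊢
    refine ⟨?_, h1⟩
    simpa [modelMul, minor, h1] using h2.1
  · simp only [mem_vanish, Finset.forall_mem_insert, Finset.mem_singleton, forall_eq] at hu ⊢
    simp [hu]
  · simp only [mem_vanish, Finset.forall_mem_insert, Finset.mem_singleton, forall_eq, h.mul_eq]
      at hu hv ⊢
    simp [modelMul, minor, hu, hv]

theorem prod_U_two (h : L.IsChart r e) (hr : r ≠ 0) : L.prod L.U (L.power 2) =
    vanish e {.inl 2, .inl 1, .inl 0, .inr 0, .inr 1, .inr 2, .inr 3, .inr 4} := by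
  rw [h.U_eq_vanish hr, h.power_two hr]
  refine le_antisymm (L.prod_le.2 fun u hu v hv => ?_) (vanish_le fun i hi => ?_)
  · simp only [mem_vanish, Finset.forall_mem_insert, Finset.mem_singleton, forall_eq, h.mul_eq]
      at hu hv ⊢
    simp [modelMul, minor, hu, hv]
  · rcases i with i | i <;> fin_cases i <;> first | exact absurd hi (by decide) | skip
    · exact h.x4_mem_prod_x1_y3 (single_mem_vanish (by decide)) (single_mem_vanish (by decide))
    · exact h.x5_mem_prod_x2_y3 (single_mem_vanish (by decide)) (single_mem_vanish (by decide))

theorem isOfType24 (h : L.IsChart r e) (hr : r ≠ 0) : L.IsOfType24 := by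
  have hd := h.hasMaximalDims hr
  obtain ⟨hn, hc⟩ := L.nilpotenceClass_eq hd.power_eight hd.power_seven_ne
  have hZ : L.centre = L.power 7 := by rw [L.centre_eq, hd.perp_power.1]
  refine ⟨hd.dim, hn, fun x hx y hy => ?_, ?_, hc, ?_, ?_⟩
  · rw [hZ] at hx hy
    exact L.form_eq_zero_of_powers hd.power_eight (by omega) hx hy
  · rw [hZ, hd.dim_seven]
  · rw [h.prod_four_three hr, h.power_seven hr]
  · rw [h.prod_U_two hr, finrank_vanish]; decide

theorem perp_prod_five_two (h : L.IsChart r e) (hr : r ≠ 0) :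
    L.perp (L.prod (L.power 5) (L.power 2)) = vanish e {.inr 4} := by
  rw [h.prod_five_two hr]
  ext v
  simp only [L.mem_perp, mem_vanish, Finset.forall_mem_insert, Finset.mem_singleton, forall_eq,
    h.form_eq]
  constructor
  · intro hv
    have := hv (e.symm (Pi.single (.inl 4) 1)) (by simp)
    simpa [modelForm, Fin.sum_univ_five] using this
  · intro hv a ha
    simp [modelForm, Fin.sum_univ_five, hv, ha]

end IsChart
end Powers

/-! ### The parameter up to eleventh powers -/

section Parameter

namespace IsChart

variable {L : SAA F V} {r s : F} {e e' : V ≃ₗ[F] (Fin 5 ⊕ Fin 5 → F)}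

theorem triple_eq (h : L.IsChart r e) (u v w : V) :
    L.form (L.mul u v) w = modelForm (modelMul r (e u) (e v)) (e w) := by
  rw [h.form_eq, h.mul_eq]

set_option maxHeartbeats 2000000 in
/-- Charts of the same algebra differ by a map that is triangular with respect to the
characteristic flag, so that comparing leading coefficients relates the two parameters. -/
theorem exists_pow_eleven (h : L.IsChart r e) (h' : L.IsChart s e') (hr : r ≠ 0) (hs : s ≠ 0) :
    ∃ a : Fˣ, s / r = (a : F) ^ 11 := by
  -- The nine members of the flag, of dimensions 1 to 9, are defined without coordinates, so both
  -- charts see the same subspaces.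
  have v1 : vanish e' {.inl 3, .inl 2, .inl 1, .inl 0, .inr 0, .inr 1, .inr 2, .inr 3, .inr 4} =
      vanish e {.inl 3, .inl 2, .inl 1, .inl 0, .inr 0, .inr 1, .inr 2, .inr 3, .inr 4} := by
    rw [← h.prod_five_two hr, ← h'.prod_five_two hs]
  have v2 : vanish e' {.inl 2, .inl 1, .inl 0, .inr 0, .inr 1, .inr 2, .inr 3, .inr 4} =
      vanish e {.inl 2, .inl 1, .inl 0, .inr 0, .inr 1, .inr 2, .inr 3, .inr 4} := by
    rw [← h.power_seven hr, ← h'.power_seven hs]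
  have v3 : vanish e' {.inl 1, .inl 0, .inr 0, .inr 1, .inr 2, .inr 3, .inr 4} =
      vanish e {.inl 1, .inl 0, .inr 0, .inr 1, .inr 2, .inr 3, .inr 4} := by
    rw [← h.power_six hr, ← h'.power_six hs]
  have v4 : vanish e' {.inl 0, .inr 0, .inr 1, .inr 2, .inr 3, .inr 4} =
      vanish e {.inl 0, .inr 0, .inr 1, .inr 2, .inr 3, .inr 4} := by
    rw [← h.power_five hr, ← h'.power_five hs]
  have v5 : vanish e' {.inr 0, .inr 1, .inr 2, .inr 3, .inr 4} =
      vanish e {.inr 0, .inr 1, .inr 2, .inr 3, .inr 4} := by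
    rw [← h.U_eq_vanish hr, ← h'.U_eq_vanish hs]
  have v6 : vanish e' {.inr 1, .inr 2, .inr 3, .inr 4} =
      vanish e {.inr 1, .inr 2, .inr 3, .inr 4} := by
    rw [← h.power_four hr, ← h'.power_four hs]
  have v7 : vanish e' {.inr 2, .inr 3, .inr 4} =
      vanish e {.inr 2, .inr 3, .inr 4} := by
    rw [← h.power_three hr, ← h'.power_three hs]
  have v8 : vanish e' {.inr 3, .inr 4} =
      vanish e {.inr 3, .inr 4} := by
    rw [← h.power_two hr, ← h'.power_two hs]
  have v9 : vanish e' {.inr 4} =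
      vanish e {.inr 4} := by
    rw [← h.perp_prod_five_two hr, ← h'.perp_prod_five_two hs]
  have x5 : (e'.symm (Pi.single (Sum.inl 4) 1)) ∈ vanish e {.inl 3, .inl 2, .inl 1, .inl 0, .inr 0,
      .inr 1, .inr 2, .inr 3, .inr 4} := by
    rw [← v1]; exact single_mem_vanish (by decide)
  have x4 : (e'.symm (Pi.single (Sum.inl 3) 1)) ∈ vanish e {.inl 2, .inl 1, .inl 0, .inr 0, .inr 1,
      .inr 2, .inr 3, .inr 4} := by
    rw [← v2]; exact single_mem_vanish (by decide)
  have x3 : (e'.symm (Pi.single (Sum.inl 2) 1)) ∈ vanish e {.inl 1, .inl 0, .inr 0, .inr 1, .inr 2,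
      .inr 3, .inr 4} := by
    rw [← v3]; exact single_mem_vanish (by decide)
  have x2 : (e'.symm (Pi.single (Sum.inl 1) 1)) ∈ vanish e {.inl 0, .inr 0, .inr 1, .inr 2, .inr 3,
      .inr 4} := by
    rw [← v4]; exact single_mem_vanish (by decide)
  have x1 : (e'.symm (Pi.single (Sum.inl 0) 1)) ∈ vanish e {.inr 0, .inr 1, .inr 2, .inr 3, .inr 4}
      := by
    rw [← v5]; exact single_mem_vanish (by decide)
  have y1 : (e'.symm (Pi.single (Sum.inr 0) 1)) ∈ vanish e {.inr 1, .inr 2, .inr 3, .inr 4} := by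
    rw [← v6]; exact single_mem_vanish (by decide)
  have y2 : (e'.symm (Pi.single (Sum.inr 1) 1)) ∈ vanish e {.inr 2, .inr 3, .inr 4} := by
    rw [← v7]; exact single_mem_vanish (by decide)
  have y3 : (e'.symm (Pi.single (Sum.inr 2) 1)) ∈ vanish e {.inr 3, .inr 4} := by
    rw [← v8]; exact single_mem_vanish (by decide)
  have y4 : (e'.symm (Pi.single (Sum.inr 3) 1)) ∈ vanish e {.inr 4} := by
    rw [← v9]; exact single_mem_vanish (by decide)
  simp only [mem_vanish, Finset.forall_mem_insert, Finset.mem_singleton, forall_eq]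
    at x5 x4 x3 x2 x1 y1 y2 y3 y4
  -- By triangularity only diagonal entries p_i, q_i (at x_i, y_i) survive in the pairings, whence
  -- p_i q_i = 1, and in the five leading triple values.
  have d1 : e (e'.symm (Pi.single (Sum.inl 0) 1)) (.inl 0) * e (e'.symm (Pi.single (Sum.inr 0) 1))
      (.inr 0) = 1 := by
    have := (h.form_eq (e'.symm (Pi.single (Sum.inl 0) 1)) (e'.symm (Pi.single (Sum.inr 0)
        1))).symm.trans
      (h'.form_eq _ _)
    simpa [modelForm, Fin.sum_univ_five, x1, y1] using this
  have d2 : e (e'.symm (Pi.single (Sum.inl 1) 1)) (.inl 1) * e (e'.symm (Pi.single (Sum.inr 1) 1))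
      (.inr 1) = 1 := by
    have := (h.form_eq (e'.symm (Pi.single (Sum.inl 1) 1)) (e'.symm (Pi.single (Sum.inr 1)
        1))).symm.trans
      (h'.form_eq _ _)
    simpa [modelForm, Fin.sum_univ_five, x2, y2] using this
  have d3 : e (e'.symm (Pi.single (Sum.inl 2) 1)) (.inl 2) * e (e'.symm (Pi.single (Sum.inr 2) 1))
      (.inr 2) = 1 := by
    have := (h.form_eq (e'.symm (Pi.single (Sum.inl 2) 1)) (e'.symm (Pi.single (Sum.inr 2)
        1))).symm.trans
      (h'.form_eq _ _)
    simpa [modelForm, Fin.sum_univ_five, x3, y3] using this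
  have d4 : e (e'.symm (Pi.single (Sum.inl 3) 1)) (.inl 3) * e (e'.symm (Pi.single (Sum.inr 3) 1))
      (.inr 3) = 1 := by
    have := (h.form_eq (e'.symm (Pi.single (Sum.inl 3) 1)) (e'.symm (Pi.single (Sum.inr 3)
        1))).symm.trans
      (h'.form_eq _ _)
    simpa [modelForm, Fin.sum_univ_five, x4, y4] using this
  have d5 : e (e'.symm (Pi.single (Sum.inl 4) 1)) (.inl 4) * e (e'.symm (Pi.single (Sum.inr 4) 1))
      (.inr 4) = 1 := by
    have := (h.form_eq (e'.symm (Pi.single (Sum.inl 4) 1)) (e'.symm (Pi.single (Sum.inr 4)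
        1))).symm.trans
      (h'.form_eq _ _)
    simpa [modelForm, Fin.sum_univ_five, x5] using this
  have t1 : r * (e (e'.symm (Pi.single (Sum.inl 2) 1)) (.inl 2) * e (e'.symm (Pi.single (Sum.inr 3)
      1)) (.inr 3) * e (e'.symm (Pi.single (Sum.inr 4) 1)) (.inr 4)) = s := by
    have := (h.triple_eq (e'.symm (Pi.single (Sum.inl 2) 1)) (e'.symm (Pi.single (Sum.inr 3) 1))
        (e'.symm (Pi.single (Sum.inr 4) 1))).symm.trans
      (h'.triple_eq _ _ _)
    simp [modelForm, modelMul, minor, Fin.sum_univ_five, x3, y4] at this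
    linear_combination this
  have t2 : e (e'.symm (Pi.single (Sum.inl 1) 1)) (.inl 1) * e (e'.symm (Pi.single (Sum.inr 2) 1))
      (.inr 2) * e (e'.symm (Pi.single (Sum.inr 4) 1)) (.inr 4) = 1 := by
    have := (h.triple_eq (e'.symm (Pi.single (Sum.inl 1) 1)) (e'.symm (Pi.single (Sum.inr 2) 1))
        (e'.symm (Pi.single (Sum.inr 4) 1))).symm.trans
      (h'.triple_eq _ _ _)
    simp [modelForm, modelMul, minor, Fin.sum_univ_five, x2, y3] at this
    linear_combination this
  have t3 : e (e'.symm (Pi.single (Sum.inl 0) 1)) (.inl 0) * e (e'.symm (Pi.single (Sum.inr 1) 1))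
      (.inr 1) * e (e'.symm (Pi.single (Sum.inr 4) 1)) (.inr 4) = 1 := by
    have := (h.triple_eq (e'.symm (Pi.single (Sum.inl 0) 1)) (e'.symm (Pi.single (Sum.inr 1) 1))
        (e'.symm (Pi.single (Sum.inr 4) 1))).symm.trans
      (h'.triple_eq _ _ _)
    simp [modelForm, modelMul, minor, Fin.sum_univ_five, x1, y2] at this
    linear_combination this
  have t4 : e (e'.symm (Pi.single (Sum.inl 0) 1)) (.inl 0) * e (e'.symm (Pi.single (Sum.inr 2) 1))
      (.inr 2) * e (e'.symm (Pi.single (Sum.inr 3) 1)) (.inr 3) = 1 := by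
    have := (h.triple_eq (e'.symm (Pi.single (Sum.inl 0) 1)) (e'.symm (Pi.single (Sum.inr 2) 1))
        (e'.symm (Pi.single (Sum.inr 3) 1))).symm.trans
      (h'.triple_eq _ _ _)
    simp [modelForm, modelMul, minor, Fin.sum_univ_five, x1, y3, y4] at this
    linear_combination this
  have t5 : e (e'.symm (Pi.single (Sum.inr 0) 1)) (.inr 0) * e (e'.symm (Pi.single (Sum.inr 1) 1))
      (.inr 1) * e (e'.symm (Pi.single (Sum.inr 3) 1)) (.inr 3) = 1 := by
    have := (h.triple_eq (e'.symm (Pi.single (Sum.inr 0) 1)) (e'.symm (Pi.single (Sum.inr 1) 1))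
        (e'.symm (Pi.single (Sum.inr 3) 1))).symm.trans
      (h'.triple_eq _ _ _)
    simp [modelForm, modelMul, minor, Fin.sum_univ_five, y1, y2, y4] at this
    linear_combination this
  generalize e (e'.symm (Pi.single (Sum.inl 0) 1)) (.inl 0) = p1 at d1 t1 t2 t3 t4 t5
  generalize e (e'.symm (Pi.single (Sum.inr 0) 1)) (.inr 0) = q1 at d1 t1 t2 t3 t4 t5
  generalize e (e'.symm (Pi.single (Sum.inl 1) 1)) (.inl 1) = p2 at d2 t1 t2 t3 t4 t5
  generalize e (e'.symm (Pi.single (Sum.inr 1) 1)) (.inr 1) = q2 at d2 t1 t2 t3 t4 t5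
  generalize e (e'.symm (Pi.single (Sum.inl 2) 1)) (.inl 2) = p3 at d3 t1 t2 t3 t4 t5
  generalize e (e'.symm (Pi.single (Sum.inr 2) 1)) (.inr 2) = q3 at d3 t1 t2 t3 t4 t5
  generalize e (e'.symm (Pi.single (Sum.inl 3) 1)) (.inl 3) = p4 at d4 t1 t2 t3 t4 t5
  generalize e (e'.symm (Pi.single (Sum.inr 3) 1)) (.inr 3) = q4 at d4 t1 t2 t3 t4 t5
  generalize e (e'.symm (Pi.single (Sum.inl 4) 1)) (.inl 4) = p5 at d5 t1 t2 t3 t4 t5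
  generalize e (e'.symm (Pi.single (Sum.inr 4) 1)) (.inr 4) = q5 at d5 t1 t2 t3 t4 t5
  have n5 : q5 ≠ 0 := right_ne_zero_of_mul_eq_one d5
  have n3 : q3 ≠ 0 := right_ne_zero_of_mul_eq_one d3
  have e2 : q2 = q3 * q5 := by linear_combination q2 * (-t2) + q3 * q5 * d2
  have e1 : q1 = q3 * q5 ^ 2 := by
    linear_combination q1 * (-t3) + q2 * q5 * d1 + q5 * e2
  have e4 : q4 = q5 ^ 2 := by
    refine mul_left_cancel₀ n3 ?_
    linear_combination (-q3 * q4) * d1 + q1 * t4 + e1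
  rw [e1, e2, e4] at t5
  rw [e4] at t1
  have hp3 : p3 = q3⁻¹ := eq_inv_of_mul_eq_one_left d3
  -- The relation q_3² q_5⁵ = 1 is parametrised by q_3 = t⁻⁵, q_5 = t², with t = q_3⁻¹ q_5⁻²; then
  -- s/r = q_3⁻¹ q_5³ = t^11.
  refine ⟨(Units.mk0 q3 n3)⁻¹ * (Units.mk0 q5 n5)⁻¹ ^ 2, ?_⟩
  have hsr : s / r = p3 * q5 ^ 3 := by
    rw [← t1]; field_simp
  rw [hsr, hp3]
  have t5' : q3 ^ 2 * q5 ^ 5 = 1 := by linear_combination t5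
  simp only [Units.val_mul, Units.val_inv_eq_inv_val, Units.val_mk0, Units.val_pow_eq_pow_val]
  field_simp
  calc q3 ^ 10 * q5 ^ 25 = (q3 ^ 2 * q5 ^ 5) ^ 5 := by ring
    _ = 1 := by rw [t5', one_pow]

end IsChart

theorem IsPresentedBy.isNormalFrame {L : SAA F V} {r : F}
    {b : Module.Basis (Fin 5 ⊕ Fin 5) F V} (h : L.IsPresentedBy b (presentation24 r)) :
    L.IsNormalFrame (fun i => b (.inl i)) (fun i => b (.inr i)) r :=
  ⟨h.isFrame, h.triple_xyy 2 3 4 (by decide) (by decide),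
    h.triple_xyy 1 2 4 (by decide) (by decide), h.triple_xyy 0 1 4 (by decide) (by decide),
    h.triple_xyy 0 2 3 (by decide) (by decide), h.triple_yyy 0 1 3 (by decide) (by decide),
    h.triple_xyy 1 2 3 (by decide) (by decide), h.triple_xyy 0 1 2 (by decide) (by decide),
    h.triple_xyy 0 1 3 (by decide) (by decide), h.triple_yyy 0 1 2 (by decide) (by decide)⟩

theorem HasPresentation.of_pow_eleven {L : SAA F V} {r s : F}
    (h : L.HasPresentation 5 (presentation24 r)) (hr : r ≠ 0) {a : Fˣ}
    (ha : s / r = (a : F) ^ 11) : L.HasPresentation 5 (presentation24 s) := by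
  obtain ⟨b, hb⟩ := h
  have hn := hb.isNormalFrame
  -- The one-parameter torus that fixes the four leading values equal to 1; on (x_3 y_4, y_5) it has
  -- weight 5 + 4 + 2 = 11.
  let c : Fin 5 → Fˣ := ![a⁻¹, a⁻¹ ^ 3, a⁻¹ ^ 5, a ^ 4, a ^ 2]
  have hs : s = r * a ^ 11 := by rw [← ha]; field_simp
  have ha0 : (a : F) ≠ 0 := a.ne_zero
  have hn' : L.IsNormalFrame (fun i => (c i : F)⁻¹ • b (.inl i)) (fun i => (c i : F) • b (.inr i))
      s := by
    refine ⟨hn.scale c, ?_, ?_, ?_, ?_, ?_, ?_, ?_, ?_, ?_⟩ <;>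
      simp [c, hn.values, hs] <;> field_simp
  exact hn'.hasPresentation (by rw [Module.finrank_eq_card_basis b]; simp)

end Parameter
end SAA

theorem proposition3p4 {F : Type*} [Field F] :
    -- every algebra with the listed properties has a presentation with a nonzero parameter
    (∀ {V : Type*} [AddCommGroup V] [Module F V] (L : SAA F V),
      L.IsOfType24 → ∃ r : F, r ≠ 0 ∧ L.HasPresentation 5 (presentation24 r)) ∧
    -- each of these presentations does describe an algebra
    (∀ r : F, r ≠ 0 →
      ∃ L : SAA F (Fin 5 ⊕ Fin 5 → F), L.HasPresentation 5 (presentation24 r)) ∧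
    -- every algebra with such a presentation has the listed properties
    (∀ {V : Type*} [AddCommGroup V] [Module F V] (L : SAA F V) (r : F), r ≠ 0 →
      L.HasPresentation 5 (presentation24 r) → L.IsOfType24) ∧
    -- two presentations describe the same algebra iff the quotient is an eleventh power
    (∀ {V W : Type*} [AddCommGroup V] [Module F V] [AddCommGroup W] [Module F W]
      (L : SAA F V) (M : SAA F W) (r s : F), r ≠ 0 → s ≠ 0 →
      L.HasPresentation 5 (presentation24 r) → M.HasPresentation 5 (presentation24 s) →
      (L.Isomorphic M ↔ ∃ a : Fˣ, s / r = (a : F) ^ 11)) := by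
  refine ⟨fun L h => h.exists_presentation,
    fun r _ => ⟨SAA.model r, SAA.model_hasPresentation r⟩, fun L r hr h => ?_,
    fun L M r s hr hs hL hM => ⟨fun hLM => ?_, fun ⟨a, ha⟩ => ?_⟩⟩
  · obtain ⟨e, he⟩ := h.exists_chart
    exact he.isOfType24 hr
  · obtain ⟨e, he⟩ := hL.exists_chart
    obtain ⟨e', he'⟩ := (hM.of_isomorphic hLM).exists_chart
    exact he.exists_pow_eleven he' hr hs
  · exact (hL.of_pow_eleven hr ha).isomorphic hM
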